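/- **Setting.** Let $k\in\mathbb N$ be the security parameter. For each $k$ fix public parameters: a finite field $\mathbb F_q$ ($q=p^e$, elements represented by their coordinates in a fixed basis over $\mathbb Z/p$, each coordinate written in binary) and a dimension $n$ with $k=\lceil n\log_2 q\rceil$; a number $\ell$ of modes; invertible $n\times n$ matrices $\mathbf E_j,\mathbf B_j$ and matrices $\mathbf Q_j$ over $\mathbb F_q$ ($j\in[\ell]$) such that all products of $n_0$ of the $\mathbf Q_j$ vanish; a strictly upper triangular $n\times n$ matrix $\mathbf M$; and a switching function $\sigma$, which determines a mode from the time $t$ and a bounded number of the most recent ciphertext blocks $\mathbf c(t),\mathbf c(t-1),\dots$. It is assumed that $\ell$ is polynomially bounded in $k$ and that $\sigma$ at time $t$ is computable by (non-uniform) machines of size and running time polynomial in $k+t$. A secret key consists of a permutation $\pi$ of $\mathbb F_q$ and, independently of it, secret invertible $n\times n$ matrices $\mathbf W,\mathbf L_j,\mathbf F_j$, drawn from a given distribution. Let $\wp$ be the entrywise action of $\pi$ on $\mathbb F_q^n$ and put $\mathbf A_j=\mathbf E_j\mathbf F_j^{-1}\mathbf B_j$, $\mathbf R_j=\mathbf E_j\mathbf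 F_j^{-1}$, $\mathbf D_j=\mathbf E_j\mathbf F_j^{-1}\mathbf L_j-\mathbf Q_j$. For an ensemble $\mathfrak X$ of random permutations $\pi$ of $\mathbb F_q$, the cipher $S^4_\sigma(\mathfrak X)$ draws $\pi$ from $\mathfrak X$ and works as follows. *Encryption* with $IV=(\mathfrak m(0),\mathbf c(0))$: choose $\mathbf s(0)\in\mathbb F_q^n$ uniformly, set $\mathbf s(1)=\mathbf s(0)$, $\mathfrak m(1)=\mathfrak m(0)$, $\mathbf c(1)=\mathbf c(0)$, and for $t\ge1$, on input of the block $\mathbf p(t)$ and with $j=\sigma(t)$, output $\mathbf c(t)$ and compute $$\mathbf c(t+1)=\mathbf L_j\mathbf s(t)+\mathbf B_j\wp(\mathbf s(t))+\mathbf F_j\wp(\mathbf p(t)),\qquad \mathfrak m(t+1)=\mathbf M\mathfrak m(t)+\mathbf c(t),$$ $$\mathbf s(t+1)=\mathbf W\mathfrak m(t)+\mathbf D_j\mathbf s(t)+\mathbf A_j\wp(\mathbf s(t))+\mathbf E_j\wp(\mathbf p(t)).$$ *Decryption update*: choose $\widehat{\mathbf s}(1)$ uniformly, set $\widehat{\mathbf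 s}(2)=\widehat{\mathbf s}(1)$, $\widehat{\mathfrak m}(2)=\mathfrak m(0)$, and for $t\ge 2$, with $j=\sigma(t-1)$ and $\widehat{\mathbf z}(t)=\mathbf L_j\widehat{\mathbf s}(t)+\mathbf B_j\wp(\widehat{\mathbf s}(t))$, $$\widehat{\mathbf s}(t+1)=\mathbf W\widehat{\mathfrak m}(t)+\mathbf D_j\widehat{\mathbf s}(t)+\mathbf A_j\wp(\widehat{\mathbf s}(t))+\mathbf R_j(\mathbf c(t)-\widehat{\mathbf z}(t)),\qquad \widehat{\mathfrak m}(t+1)=\mathbf M\widehat{\mathfrak m}(t)+\mathbf c(t-1).$$ **Oracles.** For a bit $b$, both oracles $E(IV,b)$ and $SE(IV,b)$ let the adversary open any number of sessions, each with an $IV$ of its choice (the oracle draws the random initial state and returns the session number, which $SE$ precedes by $\mathbf c(1)=\mathbf c(0)$), and then, concurrently for all sessions $i$ and blockwise adaptively, submit queries $(\mathbf p^0,\mathbf p^1,i)$. The oracle $E$ applies one step of the encryption to $\mathbf p^b$ in session $i$ and returns its output $\mathbf c(t)$. The oracle $SE$, whose first query in a session is answered at $t=2$, returns $\mathbf c(t)=\widehat{\mathbf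 z}(t)+\mathbf F_j\wp(\mathbf p^b)$ and applies the decryption update with this $\mathbf c(t)$. A query with the end-of-message symbol in place of both blocks closes the session ($E$ then returns $\mathbf c(t)$, $SE$ returns the empty word); later queries to a closed session are answered by the empty word. **Adversaries and advantage.** A non-uniform probabilistic polynomial time oracle Turing machine is a family of probabilistic oracle Turing machines, one for each $k$, whose description size and running time (for all coin tosses and oracle answers) are bounded by a polynomial in $k$. A LORBACPA$^+$ adversary $\mathcal A$ is such a machine with access to both $E(IV,b)$ and $SE(IV,b)$; in the experiment the key is generated, $b\in\{0,1\}$ is chosen uniformly, $\mathcal A$ outputs a bit $b'$, and $\mathbf{Adv}^{LORBACPA^+}_{\mathcal A,S^4_\sigma(\mathfrak X)}(k)=2\left|\Pr(b'=b)-\tfrac12\right|$. Let $\mathfrak U$ be the ensemble of uniformly random permutations of $\mathbb F_q$, and let $\mathfrak P=(\pi_\kappa)$ be a family of permutations of $\mathbb F_q$ indexed by $k$-bit keys $\kappa$, with a key distribution for each $k$, that is pseudorandom: for every non-uniform probabilistic polynomial time oracle machine $\mathcal D$, the difference $|\Pr(\mathcal D^{\pi}=1:\pi\leftarrow\mathfrak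 P)-\Pr(\mathcal D^{\pi}=1:\pi\leftarrow\mathfrak U)|$ is negligible in $k$. **Proposition.** Consider $S^4_\sigma(\mathfrak P)$ and $S^4_\sigma(\mathfrak U)$ with the same parameters and the same distribution of the secret matrices. For every LORBACPA$^+$ adversary $\mathcal A$ there is a negligible function $\mathrm{negl}$ such that, for all $k$, $$\left|\mathbf{Adv}^{LORBACPA^+}_{\mathcal A,S^4_\sigma(\mathfrak P)}(k)-\mathbf{Adv}^{LORBACPA^+}_{\mathcal A,S^4_\sigma(\mathfrak U)}(k)\right|<\mathrm{negl}(k).$$ -/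

import Mathlib

open Polynomial Filter

namespace S4

/-- A function of the security parameter is negligible if it tends to zero faster than the
inverse of every polynomial. -/
def Negligible (f : ℕ → ℝ) : Prop :=
  Asymptotics.SuperpolynomialDecay atTop (fun k : ℕ => (k : ℝ)) f

/-! ### Non-uniform probabilistic polynomial time oracle Turing machines -/

/-- The action of a control state of an oracle Turing machine with `r` work tapes and `N` control
states. The tape alphabet is `Option Bool`, with `none` as the blank. -/
inductive Instr (r N : ℕ) : Type
  /-- Read the cell under the head of work tape `i`; the symbol read determines the symbol that is
  written, the movement of the head (`none`: no movement) and the next state. -/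
  | work (i : Fin r) (next : Option Bool → Option Bool × Option Turing.Dir × Fin N) : Instr r N
  /-- Write a bit on the (write-only) query tape. -/
  | write (a : Bool) (next : Fin N) : Instr r N
  /-- Read the next bit of the (one-way, read-only) answer tape; `none` if there is none left. -/
  | read (next : Option Bool → Fin N) : Instr r N
  /-- Send the word on the query tape to the oracle. The query tape is erased and the answer tape
  now carries the oracle's answer. -/
  | ask (next : Fin N) : Instr r N
  /-- Toss a fair coin. -/
  | toss (next : Bool → Fin N) : Instr r N
  /-- Halt with an output bit. -/
  | halt (a : Bool) : Instr r N

/-- A probabilistic oracle Turing machine. -/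
structure Machine : Type where
  tapes : ℕ
  states : ℕ
  start : Fin states
  instr : Fin states → Instr tapes states

namespace Machine

/-- The size of a machine; the length of its description is polynomial in this number. -/
def size (T : Machine) : ℕ := T.tapes + T.states

structure Cfg (T : Machine) : Type where
  state : Fin T.states
  work : Fin T.tapes → Turing.Tape (Option Bool)
  query : List Bool
  answer : List Bool

/-- The initial configuration. An input word, if any, stands on the answer tape. -/
def initial (T : Machine) (input : List Bool) : T.Cfg where
  state := T.start
  work := fun _ => default
  query := []
  answer := input

/-- The output bit of a halted configuration, `none` if the configuration is not halted. -/
def output {T : Machine} (c : T.Cfg) : Option Bool :=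
  match T.instr c.state with
  | .halt a => some a
  | _ => none

/-- One step, given the outcome of the coin (used if a coin is tossed) and the oracle's answer
(used if the oracle is asked). A halted configuration does not change. -/
def stepWith {T : Machine} (coin : Bool) (ans : List Bool) (c : T.Cfg) : T.Cfg :=
  match T.instr c.state with
  | .work i next =>
    let x := next (c.work i).head
    let t := (c.work i).write x.1
    { c with
      state := x.2.2
      work := Function.update c.work i (x.2.1.elim t (fun d => t.move d)) }
  | .write a next => { c with state := next, query := c.query ++ [a] }
  | .read next => { c with state := next c.answer.head?, answer := c.answer.tail }
  | .ask next => { c with state := next, query := [], answer := ans }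
  | .toss next => { c with state := next coin }
  | .halt _ => c

/-- The configuration after `t` steps along a sequence of coins and oracle answers. -/
def runWith {T : Machine} (coins : ℕ → Bool) (answers : ℕ → List Bool) (c : T.Cfg) : ℕ → T.Cfg
  | 0 => c
  | t + 1 => stepWith (coins t) (answers t) (runWith coins answers c t)

end Machine

/-- A randomized stateful oracle: given its state and a query, it produces an answer and a new
state. -/
def Oracle (S : Type) : Type := S → List Bool → PMF (List Bool × S)

namespace Machine

/-- One step of the interaction of a machine with an oracle. -/
noncomputable def step {S : Type} {T : Machine} (O : Oracle S) (x : T.Cfg × S) :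
    PMF (T.Cfg × S) :=
  match T.instr x.1.state with
  | .toss _ => (PMF.uniformOfFintype Bool).map fun a => (stepWith a [] x.1, x.2)
  | .ask _ => (O x.2 x.1.query).map fun y => (stepWith false y.1 x.1, y.2)
  | _ => PMF.pure (stepWith false [] x.1, x.2)

/-- `t` steps of the interaction of a machine with an oracle. -/
noncomputable def run {S : Type} {T : Machine} (O : Oracle S) :
    ℕ → T.Cfg × S → PMF (T.Cfg × S)
  | 0, x => PMF.pure x
  | t + 1, x => (step O x).bind (run O t)

end Machine

/-- A non-uniform probabilistic polynomial time oracle Turing machine: for every value `k` of the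
security parameter a machine of size polynomial in `k`, that halts within a number of steps
polynomial in `k`, whatever its coins and the answers of the oracle. -/
structure PPT : Type where
  machine : ℕ → Machine
  bound : ℕ[X]
  size_le : ∀ k, (machine k).size ≤ bound.eval k
  halts : ∀ (k : ℕ) (coins : ℕ → Bool) (answers : ℕ → List Bool),
    (Machine.output
      (Machine.runWith coins answers ((machine k).initial []) (bound.eval k))).isSome

/-- The output of a polynomial time machine, for security parameter `k`, with access to an oracle
in initial state `s`. -/
noncomputable def PPT.outcome {S : Type} (A : PPT) (k : ℕ) (O : Oracle S) (s : S) :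
    PMF (Option Bool) :=
  (Machine.run O (A.bound.eval k) ((A.machine k).initial [], s)).map
    fun x => Machine.output x.1

/-! ### The public parameters of the cryptosystem -/

/-- The public parameters for the security parameter `k`. The field is `GF(q)` with `q = p ^ e`;
its elements are represented by their coordinates in a fixed basis over `ℤ/p`. -/
structure Params (k : ℕ) : Type where
  /-- dimension of the system: the length of a block -/
  n : ℕ
  p : ℕ
  [prime : Fact p.Prime]
  e : ℕ
  basis : Module.Basis (Fin e) (ZMod p) (GaloisField p e)
  /-- `k = n log q`, the length in bits of a block (rounded up) -/
  security : k = Nat.clog 2 ((p ^ e) ^ n)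
  /-- the number of modes between which the system switches -/
  ell : ℕ
  E : Fin ell → GL (Fin n) (GaloisField p e)
  B : Fin ell → GL (Fin n) (GaloisField p e)
  Q : Fin ell → Matrix (Fin n) (Fin n) (GaloisField p e)
  /-- the index of nilpotency of the semigroup generated by the matrices `Q j` -/
  index : ℕ
  nilpotent : ∀ w : Fin index → Fin ell, (List.ofFn fun i => Q (w i)).prod = 0
  M : Matrix (Fin n) (Fin n) (GaloisField p e)
  upper : ∀ i j, j ≤ i → M i j = 0
  /-- the number of delayed ciphertext blocks on which the switching function may depend -/
  window : ℕ
  /-- the switching function: `sigma t [c(t), c(t-1), …]` is the mode at time `t`, where the list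
  carries the `window` most recent ciphertext blocks (fewer if there are fewer) -/
  sigma : ℕ → List (Fin n → GaloisField p e) → Fin ell

attribute [instance] Params.prime

namespace Params

variable {k : ℕ} (P : Params k)

/-- The field `GF(q)`. -/
abbrev K : Type := GaloisField P.p P.e

abbrev Block : Type := Fin P.n → P.K

abbrev Mat : Type := Matrix (Fin P.n) (Fin P.n) P.K

/-! #### Encodings as bit strings -/

/-- The number written in binary, least significant bit first. -/
def toNumber (w : List Bool) : ℕ := Nat.ofDigits 2 (w.map Bool.toNat)

/-- Number of bits of a coordinate in `ℤ/p`. -/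
def digitBits : ℕ := Nat.clog 2 P.p

/-- Number of bits of a field element. -/
def elemBits : ℕ := P.e * P.digitBits

/-- Number of bits of a block. -/
def blockBits : ℕ := P.n * P.elemBits

noncomputable def encodeElem (x : P.K) : List Bool :=
  (List.finRange P.e).flatMap fun a =>
    List.ofFn fun i : Fin P.digitBits => (P.basis.repr x a).val.testBit i

noncomputable def encodeBlock (v : P.Block) : List Bool :=
  (List.finRange P.n).flatMap fun i => P.encodeElem (v i)

/-- The field element encoded at the beginning of a word (missing bits count as zero, and
coordinates are reduced modulo `p`). -/
noncomputable def decodeElem (w : List Bool) : P.K :=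
  ∑ a : Fin P.e,
    ((toNumber ((w.drop (a * P.digitBits)).take P.digitBits) : ℕ) : ZMod P.p) • P.basis a

/-- The block encoded at the beginning of a word. -/
noncomputable def decodeBlock (w : List Bool) : P.Block :=
  fun i => P.decodeElem (w.drop (i * P.elemBits))

/-! #### The secret matrices and the update functions -/

/-- The secret matrices. -/
structure Secret : Type where
  W : GL (Fin P.n) P.K
  L : Fin P.ell → GL (Fin P.n) P.K
  F : Fin P.ell → GL (Fin P.n) P.K

variable {P}

namespace Secret

variable (sec : P.Secret)

noncomputable def A (j : Fin P.ell) : P.Mat :=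
  (P.E j : P.Mat) * ((sec.F j)⁻¹ : GL (Fin P.n) P.K) * (P.B j : P.Mat)

noncomputable def R (j : Fin P.ell) : P.Mat :=
  (P.E j : P.Mat) * ((sec.F j)⁻¹ : GL (Fin P.n) P.K)

noncomputable def D (j : Fin P.ell) : P.Mat :=
  (P.E j : P.Mat) * ((sec.F j)⁻¹ : GL (Fin P.n) P.K) * (sec.L j : P.Mat) - P.Q j

variable (f : Equiv.Perm P.K) (j : Fin P.ell)

/-- The keystream block `L_j s + B_j ℘(s)`, where `℘` applies `f` to every entry. -/
noncomputable def keystream (s : P.Block) : P.Block :=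
  (sec.L j : P.Mat).mulVec s + (P.B j : P.Mat).mulVec (f ∘ s)

/-- The ciphertext block `z + F_j ℘(p)` that encrypts `p` in the state `s`. -/
noncomputable def cipher (s p : P.Block) : P.Block :=
  sec.keystream f j s + (sec.F j : P.Mat).mulVec (f ∘ p)

/-- The state update of the encryption, with memory vector `m` and plaintext block `p`. -/
noncomputable def encUpdate (m s p : P.Block) : P.Block :=
  (sec.W : P.Mat).mulVec m + (sec.D j).mulVec s + (sec.A j).mulVec (f ∘ s)
    + (P.E j : P.Mat).mulVec (f ∘ p)

/-- The state update of the decryption, with memory vector `m` and ciphertext block `c`. -/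
noncomputable def decUpdate (m s c : P.Block) : P.Block :=
  (sec.W : P.Mat).mulVec m + (sec.D j).mulVec s + (sec.A j).mulVec (f ∘ s)
    + (sec.R j).mulVec (c - sec.keystream f j s)

end Secret

end Params

/-- The switching functions are efficient: there are polynomially many modes, and for all `k` and
`t` the mode at time `t` is computed, from the encodings of the ciphertext blocks on which it
depends, by a machine whose size and number of steps are polynomial in `k + t`. It leaves the
mode, in binary, on its query tape. -/
def Efficient (P : ∀ k, Params k) : Prop :=
  ∃ bound : ℕ[X], (∀ k, (P k).ell ≤ bound.eval k) ∧
    ∀ k t : ℕ, ∃ T : Machine, T.size ≤ bound.eval (k + t) ∧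
      ∀ cs : List (P k).Block, cs.length = min (t + 1) (P k).window →
        ∀ (coins : ℕ → Bool) (answers : ℕ → List Bool),
          (Machine.output (Machine.runWith coins answers
            (T.initial (cs.flatMap (P k).encodeBlock)) (bound.eval (k + t)))).isSome ∧
          Params.toNumber (Machine.runWith coins answers
            (T.initial (cs.flatMap (P k).encodeBlock)) (bound.eval (k + t))).query
              = ((P k).sigma t cs : ℕ)

/-! ### The left-or-right oracles -/

/-- The two oracles: `E` applies the encryption, `SE` (synchronized encryption) applies the update
of the decryption. -/
inductive Kind : Type
  | E
  | SE
  deriving DecidableEq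

namespace Params

variable {k : ℕ} (P : Params k)

/-- The history of a session, at clock `t`. For `E`, `state` and `memory` are `s(t)` and `m(t)`;
for `SE`, which runs with delay one, they are the receiver's state and memory at time `t + 1`. -/
structure Session : Type where
  clock : ℕ
  state : P.Block
  memory : P.Block
  /-- `c(t)` -/
  current : P.Block
  /-- `[c(t-1), …, c(0)]` -/
  past : List P.Block
  /-- the end of the message has not been announced yet -/
  active : Bool

variable {P} in
/-- The mode at the clock `t` of the session. -/
def Session.mode (x : P.Session) : Fin P.ell :=
  P.sigma x.clock ((x.current :: x.past).take P.window)

variable {P} in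
/-- Encryption of the next block `p` in a session: the block that is returned, and the new history.
With `t` the clock of the session, `p` is `p(t)`; `E` computes `c(t+1)` and returns `c(t)`, and `SE`
computes and returns `c(t+1)`. -/
noncomputable def Session.encrypt (sec : P.Secret) (f : Equiv.Perm P.K) (o : Kind)
    (x : P.Session) (p : P.Block) : P.Block × P.Session :=
  let j := x.mode
  let c := sec.cipher f j x.state p
  let new : P.Block → P.Session := fun s =>
    { clock := x.clock + 1
      state := s
      memory := P.M.mulVec x.memory + x.current
      current := c
      past := x.current :: x.past
      active := true }
  match o with
  | .E => (x.current, new (sec.encUpdate f j x.memory x.state p))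
  | .SE => (c, new (sec.decUpdate f j x.memory x.state c))

/-- The requests of the adversary. Sessions are numbered `0, 1, 2, …` for each of the oracles. -/
inductive Request : Type
  /-- start a session with the initial vector `IV = (m, c)` -/
  | newSession (o : Kind) (m c : P.Block) : Request
  /-- the query `(p₀, p₁, i)` -/
  | encrypt (o : Kind) (p₀ p₁ : P.Block) (i : ℕ) : Request
  /-- the query with the end-of-message symbol in place of both blocks -/
  | close (o : Kind) (i : ℕ) : Request

/-- Requests as words. The first bit selects the oracle. -/
noncomputable def parse : List Bool → Option P.Request
  | o :: false :: w =>
    some (.newSession (bif o then .SE else .E) (P.decodeBlock w)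
      (P.decodeBlock (w.drop P.blockBits)))
  | o :: true :: false :: w =>
    some (.encrypt (bif o then .SE else .E) (P.decodeBlock w)
      (P.decodeBlock (w.drop P.blockBits)) (toNumber (w.drop (2 * P.blockBits))))
  | o :: true :: true :: w => some (.close (bif o then .SE else .E) (toNumber w))
  | _ => none

/-- The pair of oracles `E(IV, b)` and `SE(IV, b)`, which encrypt the left (`b = false`) or the
right (`b = true`) block of each query. A malformed request, or one to a session that does not
exist or has been closed, is answered by the empty word. In a new session the initial state is
chosen uniformly at random, `c(1) = c(0)`, and the memory is still `m(0)`. The answer is the number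
of the session, which `SE` precedes by `c(1)`. -/
noncomputable def oracle (sec : P.Secret) (f : Equiv.Perm P.K) (b : Bool) :
    Oracle (Kind → List P.Session) := fun st w =>
  match P.parse w with
  | some (.newSession o m c) =>
    letI : Fintype P.Block := Fintype.ofFinite _
    (PMF.uniformOfFintype P.Block).map fun s =>
      ((match o with
        | .E => []
        | .SE => P.encodeBlock c) ++ Nat.bits (st o).length,
      Function.update st o (st o ++
        [{ clock := 1, state := s, memory := m, current := c, past := [c], active := true }]))
  | some (.encrypt o p₀ p₁ i) =>
    PMF.pure <|
      match (st o)[i]? with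
      | some x =>
        if x.active then
          let y := x.encrypt sec f o (bif b then p₁ else p₀)
          (P.encodeBlock y.1, Function.update st o ((st o).set i y.2))
        else ([], st)
      | none => ([], st)
  | some (.close o i) =>
    PMF.pure <|
      match (st o)[i]? with
      | some x =>
        if x.active then
          ((match o with
            | .E => P.encodeBlock x.current
            | .SE => []),
          Function.update st o ((st o).set i { x with active := false }))
        else ([], st)
      | none => ([], st)
  | none => PMF.pure ([], st)

/-- The oracle that evaluates a permutation of the field. -/
noncomputable def permOracle (f : Equiv.Perm P.K) : Oracle Unit := fun _ w =>
  PMF.pure (P.encodeElem (f (P.decodeElem w)), ())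

end Params

/-! ### Permutation ensembles, the security experiment and advantages -/

/-- An ensemble of random permutations of the fields. -/
abbrev Ensemble (P : ∀ k, Params k) : Type := ∀ k, PMF (Equiv.Perm (P k).K)

/-- The ensemble of uniformly random permutations. -/
noncomputable def uniform (P : ∀ k, Params k) : Ensemble P := fun k =>
  letI : Fintype (Equiv.Perm (P k).K) := Fintype.ofFinite _
  PMF.uniformOfFintype _

/-- A family of permutations indexed by keys, which are strings of `k` bits, together with the
distribution of the key that is generated. -/
structure KeyedFamily (P : ∀ k, Params k) : Type where
  gen : ∀ k, PMF (Fin k → Bool)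
  perm : ∀ k, (Fin k → Bool) → Equiv.Perm (P k).K

/-- The random permutation indexed by a generated key. -/
noncomputable def KeyedFamily.ensemble {P : ∀ k, Params k} (𝔓 : KeyedFamily P) : Ensemble P :=
  fun k => (𝔓.gen k).map (𝔓.perm k)

/-- The probability that a machine with access to a random permutation of the ensemble
outputs `1`. -/
noncomputable def acceptProb {P : ∀ k, Params k} (X : Ensemble P) (T : PPT) (k : ℕ) : ℝ :=
  (((X k).bind fun f => T.outcome k ((P k).permOracle f) ()) (some true)).toReal

/-- The family is pseudorandom: no non-uniform probabilistic polynomial time machine distinguishes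
it from the uniformly random permutations with more than negligible advantage. -/
def KeyedFamily.Pseudorandom {P : ∀ k, Params k} (𝔓 : KeyedFamily P) : Prop :=
  ∀ T : PPT, Negligible fun k => |acceptProb 𝔓.ensemble T k - acceptProb (uniform P) T k|

/-- The experiment: the permutation and the secret matrices are generated, a bit `b` is chosen
uniformly, and the adversary with access to `E(IV, b)` and `SE(IV, b)` outputs a bit. The result is
`true` if this bit is `b`. -/
noncomputable def experiment (P : ∀ k, Params k) (secret : ∀ k, PMF (P k).Secret)
    (X : Ensemble P) (T : PPT) (k : ℕ) : PMF Bool :=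
  (X k).bind fun f => (secret k).bind fun sec => (PMF.uniformOfFintype Bool).bind fun b =>
    (T.outcome k ((P k).oracle sec f b) fun _ => []).map fun x => decide (x = some b)

/-- The advantage of an adversary against the cryptosystem that uses the permutations of the
ensemble, in the left-or-right model with chosen `IV` and both oracles. -/
noncomputable def advantage (P : ∀ k, Params k) (secret : ∀ k, PMF (P k).Secret)
    (X : Ensemble P) (T : PPT) (k : ℕ) : ℝ :=
  2 * |(experiment P secret X T k true).toReal - 1 / 2|

end S4

/-! The proof is a reduction: a distinguisher simulates the whole experiment and evaluates the
cipher with its oracle for the permutation f. Apart from f, the experiment depends on the secret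
matrices, the bit b, the coins of the adversary and the initial states of the sessions, all drawn
independently of f. The difference between the two success probabilities is thus a mean, over these
data, of the differences for fixed data, and some fixed choice gives a difference at least as large
in absolute value (`exists_experiment_le`). Distinguishers are non-uniform, so this choice can be
hard-wired for every k; nothing has to be sampled and no matrix has to be inverted.

What remains is a single predicate of f: with these data, the adversary outputs b. Instead of
programming a machine that decides it, the proof shows that it has a circuit with oracle gates for f
of size (N + 4) ^ 73 (`Dec.simRun`), where N is polynomial in k (`exists_feasible`). Any such
circuit becomes a Turing machine of linear size and running time with one tape per register
(`Builds.exists_machine`).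

Circuits are treated semantically: `Builds` relates sets of predicates on Ω, and a configuration or
a session is known through a finite list of observables. Three facts keep the size polynomial. A
step of the simulation reads only the observables left by the step before, so sizes add up over a
run (`Eff.iterate`). Apart from the calls of f, the arithmetic of blocks is additive in the bits, so
the matrices only enter as constants in sums modulo p (`SumOf`). The switching function is evaluated
by a circuit that follows the machine computing it (`Eff.runWith_query`).

The result is `exists_distinguisher`; the reverse triangle inequality carries it over to the
advantages. -/

namespace S4

/-! ### Straight-line programs with one-bit registers -/

/-- Instructions of a machine with an accumulator and one-bit registers named by `V`. -/
inductive Micro (V : Type) : Type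
  /-- combine the accumulator with a register -/
  | op (g : Bool → Bool → Bool) (v : V) : Micro V
  | store (v : V) : Micro V
  | write : Micro V
  | ask : Micro V
  | read : Micro V

structure Registers (V : Type) : Type where
  acc : Bool
  reg : V → Bool
  query : List Bool
  answer : List Bool

namespace Micro

variable {V : Type}

/-- The register that occurs in an instruction. -/
def var : Micro V → Option V
  | op _ v => some v
  | store v => some v
  | _ => none

open Classical in
noncomputable def exec (ans : List Bool → List Bool) : Micro V → Registers V → Registers V
  | op g v, x => { x with acc := g x.acc (x.reg v) }
  | store v, x => { x with reg := Function.update x.reg v x.acc }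
  | write, x => { x with query := x.query ++ [x.acc] }
  | ask, x => { x with query := [], answer := ans x.query }
  | read, x => { x with acc := x.answer.head?.getD false, answer := x.answer.tail }

noncomputable def execList (ans : List Bool → List Bool) (l : List (Micro V))
    (x : Registers V) : Registers V :=
  l.foldl (fun x i => i.exec ans x) x

/-- The instruction of a Turing machine that carries out an instruction of a straight-line
program, if register `v` is on tape `ν v` and `code` is the state that follows, as a function of the
accumulator. -/
def toInstr {r N : ℕ} (ν : V → Fin r) (acc : Bool) (code : Bool → Fin N) : Micro V → Instr r N
  | op g v => .work (ν v) fun a => (a, none, code (g acc (a.getD false)))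
  | store v => .work (ν v) fun _ => (some acc, none, code acc)
  | write => .write acc (code acc)
  | ask => .ask (code acc)
  | read => .read fun a => code (a.getD false)

/-- A control state is a program counter together with the accumulator bit. The counter has one
value more than the program has instructions, for halting. -/
noncomputable def code (L : ℕ) : Fin (L + 1) × Bool ≃ Fin (Fintype.card (Fin (L + 1) × Bool)) :=
  Fintype.equivFin _

/-- The Turing machine that carries out a straight-line program and outputs the accumulator. -/
noncomputable def machine {r : ℕ} (ν : V → Fin r) (l : List (Micro V)) : Machine where
  tapes := r
  states := Fintype.card (Fin (l.length + 1) × Bool)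
  start := code l.length (0, false)
  instr s :=
    let x := (code l.length).symm s
    if h : (x.1 : ℕ) < l.length then
      (l[(x.1 : ℕ)]).toInstr ν x.2 fun a => code l.length (⟨x.1 + 1, by omega⟩, a)
    else .halt x.2

variable {r : ℕ} (ν : V → Fin r) (l : List (Micro V))

lemma machine_size : (machine ν l).size = r + (l.length + 1) * 2 := by
  simp [Machine.size, machine]

/-- The machine is about to carry out the instruction number `i`. -/
def AtStep (c : (machine ν l).Cfg) (i : ℕ) (acc : Bool) : Prop :=
  ∃ h : i < l.length + 1, c.state = code l.length (⟨i, h⟩, acc)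

variable {ν l}

lemma AtStep.instr_lt {c : (machine ν l).Cfg} {i : ℕ} {acc : Bool} (h : AtStep ν l c i acc)
    (hi : i < l.length) :
    (machine ν l).instr c.state
      = (l[i]).toInstr ν acc fun a => code l.length (⟨i + 1, by omega⟩, a) := by
  obtain ⟨h1, h2⟩ := h
  simp [machine, h2, hi]

lemma AtStep.instr_end {c : (machine ν l).Cfg} {acc : Bool} (h : AtStep ν l c l.length acc) :
    (machine ν l).instr c.state = .halt acc := by
  obtain ⟨h1, h2⟩ := h
  simp [machine, h2]

lemma AtStep.stepWith_lt {c : (machine ν l).Cfg} {i : ℕ} {acc : Bool} (h : AtStep ν l c i acc)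
    (hi : i < l.length) (coin : Bool) (ans : List Bool) :
    ∃ acc', AtStep ν l (Machine.stepWith coin ans c) (i + 1) acc' := by
  have h1 := h.instr_lt hi
  rcases hl : l[i] with ⟨g, v⟩ | v | _ | _ | _ <;> rw [hl] at h1 <;> simp only [toInstr] at h1 <;>
    simp only [Machine.stepWith, h1] <;> exact ⟨_, by omega, rfl⟩

lemma AtStep.stepWith_end {c : (machine ν l).Cfg} {acc : Bool} (h : AtStep ν l c l.length acc)
    (coin : Bool) (ans : List Bool) : Machine.stepWith coin ans c = c := by
  simp only [Machine.stepWith, h.instr_end]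

/-- The counter advances by one whatever the coins and answers are, which gives the unconditional
halting that `PPT` demands. -/
lemma atStep_runWith (coins : ℕ → Bool) (answers : ℕ → List Bool) (input : List Bool) (t : ℕ) :
    ∃ acc, AtStep ν l (Machine.runWith coins answers ((machine ν l).initial input) t)
      (min t l.length) acc := by
  induction t with
  | zero => exact ⟨false, by omega, by simp [Machine.runWith, Machine.initial, machine]⟩
  | succ t ih =>
    obtain ⟨acc, h⟩ := ih
    rw [Machine.runWith]
    rcases lt_or_ge t l.length with ht | ht
    · rw [min_eq_left ht.le] at h
      rw [min_eq_left (by omega)]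
      exact h.stepWith_lt ht _ _
    · rw [min_eq_right ht] at h
      rw [min_eq_right (by omega), h.stepWith_end]
      exact ⟨_, h⟩

lemma AtStep.output_end {c : (machine ν l).Cfg} {acc : Bool} (h : AtStep ν l c l.length acc) :
    Machine.output c = some acc := by
  simp only [Machine.output, h.instr_end]

/-- The configuration of the machine represents the contents of the registers. -/
structure Represents (c : (machine ν l).Cfg) (i : ℕ) (x : Registers V) : Prop where
  atStep : AtStep ν l c i x.acc
  reg : ∀ v ∈ l.filterMap var, ((c.work (ν v)).head).getD false = x.reg v
  query : c.query = x.query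
  answer : c.answer = x.answer

/-- The heads never move, so each tape serves as a one-bit register. A `store` affects no other
register because `ν` is injective on the registers that occur. -/
lemma Represents.stepWith {c : (machine ν l).Cfg} {i : ℕ} {x : Registers V}
    (hν : Set.InjOn ν {v | v ∈ l.filterMap var})
    (h : Represents c i x) (hi : i < l.length) (ans : List Bool → List Bool) :
    Represents (Machine.stepWith false (ans c.query) c) (i + 1) ((l[i]).exec ans x) := by
  classical
  obtain ⟨h1, h2, h3, h4⟩ := h
  have h5 := h1.instr_lt hi
  have hmem : l[i] ∈ l := l.getElem_mem hi
  rcases hl : l[i] with ⟨g, v⟩ | v | _ | _ | _ <;> rw [hl] at h5 hmem <;>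
    simp only [toInstr] at h5 <;> simp only [Machine.stepWith, h5, exec]
  · have hv : v ∈ l.filterMap var := List.mem_filterMap.2 ⟨_, hmem, rfl⟩
    refine ⟨⟨by omega, ?_⟩, fun w hw => ?_, h3, h4⟩
    · simp only [h2 v hv]
      rfl
    · simp only [Option.elim]
      rw [← h2 w hw]
      -- An `op` writes back the symbol it has read, so even its own tape keeps its content.
      by_cases e : ν w = ν v
      · rw [e]
        erw [Function.update_self]
        rfl
      · erw [Function.update_of_ne e]
  · have hv : v ∈ l.filterMap var := List.mem_filterMap.2 ⟨_, hmem, rfl⟩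
    refine ⟨⟨by omega, rfl⟩, fun w hw => ?_, h3, h4⟩
    simp only [Option.elim]
    by_cases e : w = v
    · subst e
      erw [Function.update_self]
      simp [Turing.Tape.write]
    · have e' : ν w ≠ ν v := fun h => e (hν hw hv h)
      erw [Function.update_of_ne e']
      simp [Function.update_of_ne e, h2 w hw]
  · exact ⟨⟨by omega, rfl⟩, h2, by rw [h3], h4⟩
  · exact ⟨⟨by omega, rfl⟩, h2, rfl, by rw [h3]⟩
  · exact ⟨⟨by omega, by rw [h4]⟩, h2, h3, by rw [h4]⟩

lemma represents_iterate (hν : Set.InjOn ν {v | v ∈ l.filterMap var})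
    (ans : List Bool → List Bool) (t : ℕ) (ht : t ≤ l.length) :
    Represents ((fun c : (machine ν l).Cfg => Machine.stepWith false (ans c.query) c)^[t]
      ((machine ν l).initial [])) t
      (execList ans (l.take t) ⟨false, fun _ => false, [], []⟩) := by
  induction t with
  | zero => exact ⟨⟨by omega, rfl⟩, fun _ _ => rfl, rfl, rfl⟩
  | succ t ih =>
    have := (ih (by omega)).stepWith hν (by omega) ans
    rw [Function.iterate_succ_apply', List.take_succ_eq_append_getElem (by omega), execList,
      List.foldl_append]
    exact this

lemma output_iterate (hν : Set.InjOn ν {v | v ∈ l.filterMap var})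
    (ans : List Bool → List Bool) (t : ℕ) (ht : l.length ≤ t) :
    Machine.output ((fun c : (machine ν l).Cfg => Machine.stepWith false (ans c.query) c)^[t]
      ((machine ν l).initial []))
      = some (execList ans l ⟨false, fun _ => false, [], []⟩).acc := by
  have h := represents_iterate hν ans l.length le_rfl
  obtain ⟨u, rfl⟩ := Nat.exists_eq_add_of_le' ht
  rw [Function.iterate_add_apply]
  -- Steps beyond the end of the program change nothing.
  have h2 : ∀ (u : ℕ) (c : (machine ν l).Cfg) (acc : Bool), AtStep ν l c l.length acc →
      (fun c : (machine ν l).Cfg => Machine.stepWith false (ans c.query) c)^[u] c = c := by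
    intro u c acc hc
    induction u with
    | zero => rfl
    | succ u ih => rw [Function.iterate_succ_apply', ih, hc.stepWith_end]
  rw [h2 u _ _ h.atStep, h.atStep.output_end, List.take_length]

/-- No program tosses a coin, so with a deterministic oracle every step is a point mass. -/
lemma step_machine (O : Oracle Unit) (ans : List Bool → List Bool)
    (hO : ∀ w, O () w = PMF.pure (ans w, ())) (c : (machine ν l).Cfg) :
    Machine.step O (c, ()) = PMF.pure (Machine.stepWith false (ans c.query) c, ()) := by
  obtain ⟨⟨i, acc⟩, hi⟩ := (code l.length).surjective c.state
  rcases lt_or_ge (i : ℕ) l.length with h | h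
  · have h1 : AtStep ν l c i acc := ⟨by omega, by rw [← hi]⟩
    have h2 := h1.instr_lt h
    rcases hl : l[(i : ℕ)] with ⟨g, v⟩ | v | _ | _ | _ <;> rw [hl] at h2 <;>
      simp only [toInstr] at h2 <;> simp only [Machine.step, Machine.stepWith, h2]
    simp [hO, PMF.pure_map]
  · have h1 : AtStep ν l c l.length acc :=
      ⟨by omega, by rw [← hi]; congr; exact Fin.ext (by simp; omega)⟩
    simp only [Machine.step, Machine.stepWith, h1.instr_end]

lemma run_machine (O : Oracle Unit) (ans : List Bool → List Bool)
    (hO : ∀ w, O () w = PMF.pure (ans w, ())) (t : ℕ) (c : (machine ν l).Cfg) :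
    Machine.run O t (c, ()) = PMF.pure
      ((fun c : (machine ν l).Cfg => Machine.stepWith false (ans c.query) c)^[t] c, ()) := by
  induction t generalizing c with
  | zero => rfl
  | succ t ih =>
    rw [Machine.run, step_machine O ans hO, PMF.pure_bind, ih, Function.iterate_succ_apply]

end Micro

/-- A straight-line program is carried out by a machine of linear size in linear time. -/
theorem exists_machine_of_program {V : Type} (l : List (Micro V)) :
    ∃ T : Machine, T.size ≤ 3 * l.length + 3 ∧
      (∀ t, l.length ≤ t → ∀ coins answers,
        (Machine.output (Machine.runWith coins answers (T.initial []) t)).isSome) ∧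
      ∀ (ans : List Bool → List Bool) (O : Oracle Unit),
        (∀ w, O () w = PMF.pure (ans w, ())) → ∀ t, l.length ≤ t →
        (Machine.run O t (T.initial [], ())).map (fun x => Machine.output x.1)
          = PMF.pure (some (Micro.execList ans l ⟨false, fun _ => false, [], []⟩).acc) := by
  classical
  have hlen : (l.filterMap Micro.var).length ≤ l.length := List.length_filterMap_le _ _
  -- A register that does not occur in the program gets the index one past the end of the list; this
  -- is why one spare tape is allowed for.
  let ν : V → Fin (l.length + 1) := fun v => ⟨(l.filterMap Micro.var).idxOf v, by
    have := List.idxOf_le_length (a := v) (l := l.filterMap Micro.var)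
    omega⟩
  have hν : Set.InjOn ν {v | v ∈ l.filterMap Micro.var} := by
    intro v hv w hw h
    exact (List.idxOf_inj hv).1 (congrArg Fin.val h)
  refine ⟨Micro.machine ν l, by rw [Micro.machine_size]; omega, fun t ht coins answers => ?_,
    fun ans O hO t ht => ?_⟩
  · obtain ⟨acc, h⟩ := Micro.atStep_runWith (ν := ν) (l := l) coins answers [] t
    rw [min_eq_right ht] at h
    simp [h.output_end]
  · rw [Micro.run_machine O ans hO, PMF.pure_map]
    exact congrArg _ (Micro.output_iterate hν ans t ht)

/-! ### Circuits with oracle gates -/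

section Builds

variable {Ω : Type} (φ : Ω → List Bool → List Bool)

/-- `Builds φ S c T`: from the predicates in `S`, those in `T` are computed by a circuit of size `c`
that contains oracle gates for `φ`. -/
inductive Builds : Set (Ω → Prop) → ℕ → Set (Ω → Prop) → Prop
  | sub {S T : Set (Ω → Prop)} : T ⊆ S → Builds S 0 T
  | const {S : Set (Ω → Prop)} (a : Prop) : Builds S 1 {fun _ => a}
  | gate {S : Set (Ω → Prop)} (g : Prop → Prop → Prop) {p q : Ω → Prop} :
      p ∈ S → q ∈ S → Builds S 1 {fun ω => g (p ω) (q ω)}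
  | oracle {S : Set (Ω → Prop)} (u v : List (Ω → Prop)) (x : Ω → List Bool) :
      (∀ p ∈ u, p ∈ S) → (∀ ω, List.Forall₂ (fun p b => p ω ↔ b = true) u (x ω)) →
      (∀ ω, List.Forall₂ (fun p b => p ω ↔ b = true) v (φ ω (x ω))) →
      Builds S (u.length + v.length + 1) {p | p ∈ v}
  | trans {S T U : Set (Ω → Prop)} {c d : ℕ} :
      Builds S c T → Builds (S ∪ T) d U → Builds S (c + d) (T ∪ U)
  | mono {S T U : Set (Ω → Prop)} {c d : ℕ} : Builds S c T → c ≤ d → U ⊆ T → Builds S d U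

variable {φ}

/-- The registers named by the predicates in `R` carry their truth values. -/
def Correct (ω : Ω) (R : Set (Ω → Prop)) (x : Registers (Ω → Prop)) : Prop :=
  ∀ p ∈ R, (x.reg p = true ↔ p ω)

open Classical in
lemma Micro.execList_writes (ω : Ω) (ans : List Bool → List Bool) (u : List (Ω → Prop))
    (w : List Bool) (h : List.Forall₂ (fun p b => p ω ↔ b = true) u w)
    (x : Registers (Ω → Prop)) (hx : Correct ω {p | p ∈ u} x) :
    ∃ a, Micro.execList ans (u.flatMap fun p => [.op (fun _ b => b) p, .write]) x
      = { x with acc := a, query := x.query ++ w } := by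
  induction h generalizing x with
  | nil => exact ⟨x.acc, by simp [Micro.execList]⟩
  | @cons p b u w h1 h2 ih =>
    have hp : x.reg p = b := by
      have := hx p (by simp)
      rw [h1] at this
      exact Bool.eq_iff_iff.2 this
    obtain ⟨a, ha⟩ := ih { x with acc := b, query := x.query ++ [b] }
      (fun q hq => hx q (List.mem_cons_of_mem _ hq))
    refine ⟨a, ?_⟩
    simp only [Micro.execList, List.flatMap_cons, List.foldl_append, List.foldl_cons,
      List.foldl_nil, Micro.exec, hp] at ha ⊢
    rw [ha]
    simp

open Classical in
lemma Micro.execList_reads (ω : Ω) (ans : List Bool → List Bool) (v : List (Ω → Prop))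
    (w : List Bool) (h : List.Forall₂ (fun p b => p ω ↔ b = true) v w)
    (x : Registers (Ω → Prop)) (hw : x.answer = w) (R : Set (Ω → Prop)) (hx : Correct ω R x) :
    let y := Micro.execList ans (v.flatMap fun p => [.read, .store p]) x
    y.query = x.query ∧ Correct ω (R ∪ {p | p ∈ v}) y := by
  induction h generalizing x R with
  | nil => exact ⟨rfl, by simpa [Micro.execList] using hx⟩
  | @cons p b v w h1 h2 ih =>
    obtain ⟨h3, h4⟩ := ih
      { x with acc := b, answer := w, reg := Function.update x.reg p b } rfl (insert p R) (by
        rintro q hq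
        by_cases e : q = p
        · subst e
          simp [h1]
        · simpa [Function.update_of_ne e] using hx q (hq.resolve_left e))
    simp only [Micro.execList, List.flatMap_cons, List.foldl_append, List.foldl_cons,
      List.foldl_nil, Micro.exec, hw, List.head?_cons, Option.getD_some, List.tail_cons] at h3 h4 ⊢
    refine ⟨h3, fun q hq => h4 q ?_⟩
    simp only [Set.mem_union, Set.mem_ofPred_eq, List.mem_cons, Set.mem_insert_iff] at hq ⊢
    tauto

open Classical in
-- Induction on the circuit. The claim covers every `R` containing `S`, and `R` stays correct,
-- because in `trans` the second program still reads registers from before the first. The factor 3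
-- is the cost of a gate: load, combine, store.
theorem Builds.exists_program {S T : Set (Ω → Prop)} {c : ℕ} (h : Builds φ S c T) :
    ∃ l : List (Micro (Ω → Prop)), l.length ≤ 3 * c ∧
      ∀ (ω : Ω) (R : Set (Ω → Prop)) (x : Registers (Ω → Prop)), S ⊆ R → Correct ω R x →
        x.query = [] →
        (Micro.execList (φ ω) l x).query = [] ∧
          Correct ω (R ∪ T) (Micro.execList (φ ω) l x) := by
  -- A register is named by the predicate whose value it carries. Storing to a name that is already
  -- in use is therefore harmless.
  have key : ∀ (ω : Ω) (R : Set (Ω → Prop)) (x : Registers (Ω → Prop)) (p : Ω → Prop) (b : Bool),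
      Correct ω R x → (b = true ↔ p ω) → ∀ (y : Registers (Ω → Prop)),
      y.reg = Function.update x.reg p b → Correct ω (R ∪ {p}) y := by
    intro ω R x p b hx hb y hy q hq
    rw [hy]
    by_cases e : q = p
    · subst e
      simpa using hb
    · rw [Function.update_of_ne e]
      exact hx q (hq.resolve_right e)
  induction h with
  | sub h =>
    refine ⟨[], by simp, fun ω R x hS hx hq => ⟨hq, ?_⟩⟩
    rw [Set.union_eq_self_of_subset_right (h.trans hS)]
    exact hx
  | const a =>
    refine ⟨[.op (fun _ _ => decide a) (fun _ => a), .store fun _ => a], by simp,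
      fun ω R x hS hx hq => ⟨by simpa [Micro.execList, Micro.exec], ?_⟩⟩
    exact key ω R x _ (decide a) hx (by simp) _ (by simp [Micro.execList, Micro.exec])
  | @gate S g p q hp hq =>
    refine ⟨[.op (fun _ b => b) p, .op (fun a b => decide (g (a = true) (b = true))) q,
      .store fun ω => g (p ω) (q ω)], by simp,
      fun ω R x hS hx hx' => ⟨by simpa [Micro.execList, Micro.exec], ?_⟩⟩
    refine key ω R x _ (decide (g (p ω) (q ω))) hx (by simp) _ ?_
    simp [Micro.execList, Micro.exec, (hx p (hS hp)), (hx q (hS hq))]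
  | @oracle S u v w hu h1 h2 =>
    refine ⟨(u.flatMap fun p => [.op (fun _ b => b) p, .write]) ++ [.ask]
      ++ (v.flatMap fun p => [.read, .store p]), ?_, fun ω R x hS hx hx' => ?_⟩
    · simp
      omega
    · obtain ⟨a, ha⟩ := Micro.execList_writes ω (φ ω) u (w ω) (h1 ω) x
        (fun p hp => hx p (hS (hu p hp)))
      have h3 := Micro.execList_reads ω (φ ω) v _ (h2 ω)
        { x with acc := a, query := [], answer := φ ω (w ω) } rfl R hx
      simp only [Micro.execList, List.foldl_append] at ha h3 ⊢
      rw [ha]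
      simpa [Micro.exec, hx'] using h3
  | trans h1 h2 ih1 ih2 =>
    obtain ⟨l1, hl1, ih1⟩ := ih1
    obtain ⟨l2, hl2, ih2⟩ := ih2
    refine ⟨l1 ++ l2, by simp; omega, fun ω R x hS hx hq => ?_⟩
    obtain ⟨h3, h4⟩ := ih1 ω R x hS hx hq
    have h5 := ih2 ω _ _ (Set.union_subset_union_left _ hS) h4 h3
    rw [Set.union_assoc] at h5
    simpa only [Micro.execList, List.foldl_append] using h5
  | mono h1 h2 h3 ih =>
    obtain ⟨l, hl, ih⟩ := ih
    refine ⟨l, by omega, fun ω R x hS hx hq => ?_⟩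
    obtain ⟨h4, h5⟩ := ih ω R x hS hx hq
    exact ⟨h4, fun p hp => h5 p (Set.union_subset_union_right _ h3 hp)⟩

open Classical in
/-- A predicate computed by a circuit is computed by a machine of linear size in linear time. -/
theorem Builds.exists_machine {p : Ω → Prop} {c : ℕ} (h : Builds φ ∅ c {p}) :
    ∃ T : Machine, T.size ≤ 9 * c + 6 ∧
      (∀ t, 3 * c + 1 ≤ t → ∀ coins answers,
        (Machine.output (Machine.runWith coins answers (T.initial []) t)).isSome) ∧
      ∀ (ω : Ω) (O : Oracle Unit),
        (∀ w, O () w = PMF.pure (φ ω w, ())) → ∀ t, 3 * c + 1 ≤ t →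
        (Machine.run O t (T.initial [], ())).map (fun x => Machine.output x.1)
          = PMF.pure (some (decide (p ω))) := by
  obtain ⟨l, hl, h⟩ := h.exists_program
  -- One further instruction loads the register `p` into the accumulator, which is the output; hence
  -- `3 * c + 1` instructions.
  obtain ⟨T, h1, h2, h3⟩ := exists_machine_of_program (l ++ [.op (fun _ b => b) p])
  simp only [List.length_append, List.length_singleton] at h1 h2 h3
  refine ⟨T, by omega, fun t ht => h2 t (by omega), fun ω O hO t ht => ?_⟩
  rw [h3 (φ ω) O hO t (by omega)]
  obtain ⟨-, h4⟩ := h ω ∅ ⟨false, fun _ => false, [], []⟩ le_rfl (by simp [Correct]) rfl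
  have h5 := h4 p (by simp)
  congr 2
  rw [Bool.eq_iff_iff, decide_eq_true_iff, ← h5]
  simp [Micro.execList, Micro.exec]

end Builds

/-! ### Circuits of polynomial size -/

section Eff

variable {Ω : Type} {φ : Ω → List Bool → List Bool} {N : ℕ}

lemma Builds.mono_left {S S' T : Set (Ω → Prop)} {c : ℕ} (h : Builds φ S c T) (hS : S ⊆ S') :
    Builds φ S' c T := by
  induction h generalizing S' with
  | sub h => exact .sub (h.trans hS)
  | const a => exact .const a
  | gate g hp hq => exact .gate g (hS hp) (hS hq)
  | oracle u v x hu h1 h2 => exact .oracle u v x (fun p hp => hS (hu p hp)) h1 h2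
  | trans h1 h2 ih1 ih2 => exact .trans (ih1 hS) (ih2 (Set.union_subset_union_left _ hS))
  | mono h1 h2 h3 ih => exact .mono (ih hS) h2 h3

lemma Builds.bind {S T U : Set (Ω → Prop)} {c d : ℕ} (h : Builds φ S c T)
    (h' : Builds φ (S ∪ T) d U) : Builds φ S (c + d) U :=
  (h.trans h').mono le_rfl Set.subset_union_right

lemma Builds.union {S T U : Set (Ω → Prop)} {c d : ℕ} (h : Builds φ S c T)
    (h' : Builds φ S d U) : Builds φ S (c + d) (T ∪ U) :=
  h.trans (h'.mono_left Set.subset_union_left)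

variable (φ N) in
/-- The predicates in `T` are computed from those in `S` by a circuit of size `(N + 4) ^ d`. -/
def Eff (S : Set (Ω → Prop)) (d : ℕ) (T : Set (Ω → Prop)) : Prop :=
  Builds φ S ((N + 4) ^ d) T

variable (φ N) in
/-- The predicate `p` is computed from those in `S` by a circuit of size `(N + 4) ^ d`. -/
abbrev Dec (S : Set (Ω → Prop)) (d : ℕ) (p : Ω → Prop) : Prop := Eff φ N S d {p}

variable {S S' T T' U : Set (Ω → Prop)} {a b c d e : ℕ} {p q r : Ω → Prop}

/-- With x the next lower power, this is 2x + 2 ≤ 4x. The base `N + 4` lets the exponent absorb all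
constants, so that only the depth of nested constructions has to be counted. -/
lemma pow_add_pow_le (N : ℕ) {a b d : ℕ} (ha : a < d) (hb : b < d) :
    (N + 4) ^ a + (N + 4) ^ b + 2 ≤ (N + 4) ^ d := by
  obtain ⟨d, rfl⟩ : ∃ e, d = e + 1 := ⟨d - 1, by omega⟩
  have h1 : (N + 4) ^ a ≤ (N + 4) ^ d := Nat.pow_le_pow_right (by omega) (by omega)
  have h2 : (N + 4) ^ b ≤ (N + 4) ^ d := Nat.pow_le_pow_right (by omega) (by omega)
  have h3 : 1 ≤ (N + 4) ^ d := Nat.one_le_pow _ _ (by omega)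
  have h4 : (N + 4) ^ (d + 1) = (N + 4) ^ d * N + 4 * (N + 4) ^ d := by ring
  rw [h4]
  have := Nat.zero_le ((N + 4) ^ d * N)
  omega

lemma Eff.mono (h : Eff φ N S a T) (hS : S ⊆ S') (hd : a ≤ d) (hT : T' ⊆ T) :
    Eff φ N S' d T' :=
  Builds.mono (Builds.mono_left h hS) (Nat.pow_le_pow_right (by omega) hd) hT

lemma Eff.le (h : Eff φ N S a T) (hd : a ≤ d) : Eff φ N S d T := h.mono le_rfl hd le_rfl

lemma Eff.left (h : Eff φ N S a T) (hS : S ⊆ S') : Eff φ N S' a T := h.mono hS le_rfl le_rfl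

lemma Eff.right (h : Eff φ N S a T) (hT : T' ⊆ T) : Eff φ N S a T' := h.mono le_rfl le_rfl hT

lemma Eff.of_subset (h : T ⊆ S) : Eff φ N S d T := Builds.mono (.sub h) (Nat.zero_le _) le_rfl

lemma Eff.trans (h : Eff φ N S a T) (h' : Eff φ N (S ∪ T) b U) (ha : a < d) (hb : b < d) :
    Eff φ N S d (T ∪ U) :=
  (Builds.trans h h').mono (by have := pow_add_pow_le N ha hb; omega) le_rfl

lemma Eff.bind (h : Eff φ N S a T) (h' : Eff φ N (S ∪ T) b U) (ha : a < d) (hb : b < d) :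
    Eff φ N S d U :=
  (h.trans h' ha hb).right Set.subset_union_right

lemma Eff.union (h : Eff φ N S a T) (h' : Eff φ N S b U) (ha : a < d) (hb : b < d) :
    Eff φ N S d (T ∪ U) :=
  h.trans (h'.left Set.subset_union_left) ha hb

lemma Builds.list {ι : Type*} (l : List ι) {T : ι → Set (Ω → Prop)} {c : ℕ}
    (h : ∀ i ∈ l, Builds φ S c (T i)) : Builds φ S (l.length * c) {p | ∃ i ∈ l, p ∈ T i} := by
  induction l with
  | nil => exact .mono (.sub (T := ∅) (by simp)) (by simp) (by simp)
  | cons i l ih =>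
    refine ((h i (by simp)).union (ih fun j hj => h j (by simp [hj]))).mono ?_ ?_
    · rw [List.length_cons]
      exact le_of_eq (by ring)
    · rintro p ⟨j, hj, hp⟩
      rcases List.mem_cons.1 hj with rfl | hj
      · exact .inl hp
      · exact .inr ⟨j, hj, hp⟩

lemma Eff.list {ι : Type*} (l : List ι) {T : ι → Set (Ω → Prop)} (h : ∀ i ∈ l, Eff φ N S a (T i))
    (hl : l.length ≤ (N + 4) ^ e) (hd : a + e ≤ d) : Eff φ N S d {p | ∃ i ∈ l, p ∈ T i} := by
  refine (Builds.list l h).mono ?_ le_rfl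
  calc _ ≤ (N + 4) ^ e * (N + 4) ^ a := Nat.mul_le_mul_right _ hl
    _ = (N + 4) ^ (a + e) := by ring
    _ ≤ _ := Nat.pow_le_pow_right (by omega) hd

/-- Every step starts from `T t` alone, so the costs add up, and `(N + 4) ^ e` steps add only `e` to
the exponent. Composing the steps with `Eff.bind` would raise the exponent at every step. -/
lemma Eff.iterate {T : ℕ → Set (Ω → Prop)} (m : ℕ) (h : ∀ t < m, Eff φ N (T t) a (T (t + 1)))
    (hm : m ≤ (N + 4) ^ e) (hd : a + e ≤ d) : Eff φ N (T 0) d (T m) := by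
  have key : ∀ t ≤ m, Builds φ (T 0) (t * (N + 4) ^ a) (T t) := by
    intro t ht
    induction t with
    | zero => exact .mono (.sub le_rfl) (by simp) le_rfl
    | succ t ih =>
      refine ((ih (by omega)).bind (Builds.mono_left (h t (by omega))
        Set.subset_union_right)).mono (le_of_eq (by ring)) le_rfl
  refine (key m le_rfl).mono ?_ le_rfl
  calc _ ≤ (N + 4) ^ e * (N + 4) ^ a := Nat.mul_le_mul_right _ hm
    _ = (N + 4) ^ (a + e) := by ring
    _ ≤ _ := Nat.pow_le_pow_right (by omega) hd

lemma Dec.of_mem (h : p ∈ S) : Dec φ N S d p := Eff.of_subset (by simpa)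

lemma Eff.congr (h : Dec φ N S a p) (hpq : ∀ ω, p ω ↔ q ω) : Dec φ N S a q := by
  rwa [← show p = q from funext fun ω => propext (hpq ω)]

lemma Dec.const (a : Prop) : Dec φ N S d (fun _ => a) :=
  Builds.mono (.const a) (Nat.one_le_pow _ _ (by omega)) le_rfl

lemma Builds.gate' (g : Prop → Prop → Prop) (hp : Builds φ S a {p}) (hq : Builds φ S b {q}) :
    Builds φ S (a + b + 1) {fun ω => g (p ω) (q ω)} :=
  (hp.union hq).bind (.gate g (by simp) (by simp))

lemma Eff.gate (g : Prop → Prop → Prop) (hp : Dec φ N S a p) (hq : Dec φ N S b q) (ha : a < d)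
    (hb : b < d) : Dec φ N S d (fun ω => g (p ω) (q ω)) :=
  (Builds.gate' g hp hq).mono (by have := pow_add_pow_le N ha hb; omega) le_rfl

lemma Eff.and (hp : Dec φ N S a p) (hq : Dec φ N S b q) (ha : a < d) (hb : b < d) :
    Dec φ N S d (fun ω => p ω ∧ q ω) := hp.gate And hq ha hb

lemma Eff.or (hp : Dec φ N S a p) (hq : Dec φ N S b q) (ha : a < d) (hb : b < d) :
    Dec φ N S d (fun ω => p ω ∨ q ω) := hp.gate Or hq ha hb

lemma Eff.not (hp : Dec φ N S a p) (ha : a < d) : Dec φ N S d (fun ω => ¬ p ω) :=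
  hp.gate (fun x _ => ¬ x) hp ha ha

lemma Eff.ite (hr : Dec φ N S a r) (hp : Dec φ N S b p) (hq : Dec φ N S c q)
    (ha : a + 2 ≤ d) (hb : b + 2 ≤ d) (hc : c + 2 ≤ d) :
    Dec φ N S d (fun ω => (r ω ∧ p ω) ∨ (¬ r ω ∧ q ω)) :=
  Eff.or (d := d) (a := d - 1) (b := d - 1) (hr.and hp (by omega) (by omega))
    (hr.gate (fun x y => ¬ x ∧ y) hq (by omega) (by omega)) (by omega) (by omega)

lemma Dec.exists_list {ι : Type*} (l : List ι) {p : ι → Ω → Prop}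
    (h : ∀ i ∈ l, Dec φ N S a (p i)) (hl : l.length ≤ (N + 4) ^ e) (hd : a + e + 1 ≤ d) :
    Dec φ N S d (fun ω => ∃ i ∈ l, p i ω) := by
  have key : Builds φ S (l.length * ((N + 4) ^ a + 1) + 1) {fun ω => ∃ i ∈ l, p i ω} := by
    clear hl
    induction l with
    | nil => exact .mono (.const False) (by simp) (by simp)
    | cons i l ih =>
      have h1 := Builds.gate' Or (h i (by simp)) (ih fun j hj => h j (by simp [hj]))
      refine h1.mono ?_ ?_
      · rw [List.length_cons]
        exact le_of_eq (by ring)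
      · simp
  refine key.mono ?_ le_rfl
  have h1 : 1 ≤ (N + 4) ^ a := Nat.one_le_pow _ _ (by omega)
  have h2 : 1 ≤ (N + 4) ^ e := Nat.one_le_pow _ _ (by omega)
  calc l.length * ((N + 4) ^ a + 1) + 1
      ≤ (N + 4) ^ e * ((N + 4) ^ a + 1) + 1 := by gcongr
    _ ≤ (N + 4) ^ e * ((N + 4) ^ a * 4) := by nlinarith
    _ ≤ (N + 4) ^ e * ((N + 4) ^ a * (N + 4)) := by gcongr; omega
    _ = (N + 4) ^ (a + e + 1) := by ring
    _ ≤ _ := Nat.pow_le_pow_right (by omega) hd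

lemma Dec.forall_list {ι : Type*} (l : List ι) {p : ι → Ω → Prop}
    (h : ∀ i ∈ l, Dec φ N S a (p i)) (hl : l.length ≤ (N + 4) ^ e) (hd : a + e + 3 ≤ d) :
    Dec φ N S d (fun ω => ∀ i ∈ l, p i ω) :=
  ((Dec.exists_list (d := d - 1) (a := a + 1) l (fun i hi => (h i hi).not (by omega)) hl
    (by omega)).not (by omega)).congr (by simp)

/-- Case distinction over the values of `x`. -/
lemma Dec.cases {α : Type*} (x : Ω → α) (l : List α) {p : α → Ω → Prop}
    (hx : ∀ y ∈ l, Dec φ N S b (fun ω => x ω = y)) (h : ∀ y ∈ l, Dec φ N S a (p y))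
    (hl : l.length ≤ (N + 4) ^ e) (hn : ∀ ω, x ω ∉ l → ¬ p (x ω) ω)
    (hb : b + e + 2 ≤ d) (hd : a + e + 2 ≤ d) :
    Dec φ N S d (fun ω => p (x ω) ω) := by
  refine (Dec.exists_list (a := max a b + 1) (d := d) l (p := fun y ω => x ω = y ∧ p y ω)
    (fun y hy => (hx y hy).and (h y hy) (by omega) (by omega)) hl (by omega)).congr fun ω => ?_
  constructor
  · rintro ⟨y, -, rfl, h⟩
    exact h
  · intro h
    by_cases hm : x ω ∈ l
    · exact ⟨x ω, hm, rfl, h⟩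
    · exact absurd h (hn ω hm)

/-! #### Observables -/

/-- The values of a list of observables at `x`. -/
def obs {α : Type*} (O : List (α → Prop)) (x : Ω → α) : Set (Ω → Prop) :=
  {p | ∃ ψ ∈ O, p = fun ω => ψ (x ω)}

lemma mem_obs {α : Type*} {O : List (α → Prop)} {ψ : α → Prop} (h : ψ ∈ O) (x : Ω → α) :
    (fun ω => ψ (x ω)) ∈ obs O x := ⟨ψ, h, rfl⟩

variable {α : Type*} {O : List (α → Prop)} {x y : Ω → α}

lemma Eff.dec (h : Eff φ N S a (obs O x)) {ψ : α → Prop} (hψ : ψ ∈ O) :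
    Dec φ N S a (fun ω => ψ (x ω)) := h.right (by simpa using mem_obs hψ x)

lemma Eff.of_forall (h : ∀ ψ ∈ O, Dec φ N S a (fun ω => ψ (x ω))) (hO : O.length ≤ (N + 4) ^ e)
    (hd : a + e ≤ d) : Eff φ N S d (obs O x) := by
  refine (Eff.list O h hO hd).right ?_
  rintro _ ⟨ψ, hψ, rfl⟩
  exact ⟨ψ, hψ, rfl⟩

variable (φ N) in
/-- The observables in `O` of the value `x` are computed by circuits of size `(N + 4) ^ a`. -/
def Sees (S : Set (Ω → Prop)) (a : ℕ) (O : List (α → Prop)) (x : Ω → α) : Prop :=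
  ∀ ψ ∈ O, Dec φ N S a fun ω => ψ (x ω)

lemma Eff.sees (h : Eff φ N S a (S4.obs O x)) : Sees φ N S a O x := fun _ hψ => h.dec hψ

lemma Sees.eff (h : Sees φ N S a O x) (hO : O.length ≤ (N + 4) ^ e) (hd : a + e ≤ d) :
    Eff φ N S d (S4.obs O x) := Eff.of_forall h hO hd

lemma Sees.le (h : Sees φ N S a O x) (hd : a ≤ d) : Sees φ N S d O x :=
  fun ψ hψ => (h ψ hψ).le hd

lemma Sees.congr (h : Sees φ N S a O x) (hxy : ∀ ω, x ω = y ω) : Sees φ N S a O y := by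
  rwa [← show x = y from funext hxy]

lemma Sees.const (z : α) : Sees φ N S a O fun _ => z := fun _ _ => Dec.const _

open Classical in
lemma Sees.ite (hr : Dec φ N S a r) (hx : Sees φ N S b O x) (hy : Sees φ N S c O y)
    (ha : a + 2 ≤ d) (hb : b + 2 ≤ d) (hc : c + 2 ≤ d) :
    Sees φ N S d O fun ω => if r ω then x ω else y ω := by
  refine fun ψ hψ => (Eff.ite hr (hx ψ hψ) (hy ψ hψ) ha hb hc).congr fun ω => ?_
  by_cases h : r ω <;> simp [h]

lemma Sees.cases {β : Type*} (z : Ω → β) (l : List β) {x : β → Ω → α}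
    (hz : ∀ y ∈ l, Dec φ N S b (fun ω => z ω = y)) (h : ∀ y ∈ l, Sees φ N S a O (x y))
    (hl : l.length ≤ (N + 4) ^ e) (hm : ∀ ω, z ω ∈ l) (hb : b + e + 2 ≤ d) (hd : a + e + 2 ≤ d) :
    Sees φ N S d O (fun ω => x (z ω) ω) := fun ψ hψ =>
  Dec.cases z l (p := fun y ω => ψ (x y ω)) hz (fun y hy => h y hy ψ hψ) hl
    (fun ω hω => absurd (hm ω) hω) hb hd

/-- The observables that tell which element of a list a value is. -/
def eqs (l : List α) : List (α → Prop) := l.map fun a x => x = a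

@[simp] lemma length_eqs (l : List α) : (eqs l).length = l.length := by simp [eqs]

lemma mem_eqs {l : List α} {a : α} (h : a ∈ l) : (fun x => x = a) ∈ eqs l :=
  List.mem_map.2 ⟨a, h, rfl⟩

/-! #### Words -/

/-- The letter of a word at a position, or the absence of one. -/
def letters : List (Option Bool) := [none, some false, some true]

lemma mem_letters (a : Option Bool) : a ∈ letters := by
  rcases a with _ | _ | _ <;> simp [letters]

/-- The first `n` letters of a word. -/
def wordObs (n : ℕ) : List (List Bool → Prop) :=
  (List.range n).flatMap fun i => (eqs letters).map fun ψ w => ψ w[i]?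

lemma length_wordObs (n : ℕ) : (wordObs n).length = n * 3 := by
  simp [wordObs, letters, List.length_flatMap]

lemma mem_wordObs {n : ℕ} {ψ : List Bool → Prop} :
    ψ ∈ wordObs n ↔ ∃ i < n, ∃ a, ψ = fun w => w[i]? = a := by
  simp only [wordObs, List.mem_flatMap, List.mem_range, List.mem_map, eqs]
  constructor
  · rintro ⟨i, hi, _, ⟨a, -, rfl⟩, rfl⟩
    exact ⟨i, hi, a, rfl⟩
  · rintro ⟨i, hi, a, rfl⟩
    exact ⟨i, hi, _, ⟨a, mem_letters a, rfl⟩, rfl⟩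

variable {w : Ω → List Bool}

/-- Position `i` is the end of `w` if it is empty and either `i = 0` or position `i - 1` is
occupied. So the new letter can be placed without knowing the length of `w`. -/
lemma getElem?_concat_eq (w : List Bool) (b : Bool) (i : ℕ) (c : Option Bool) :
    (w ++ [b])[i]? = c ↔
      (w[i]? ≠ none ∧ w[i]? = c) ∨
        (¬ w[i]? ≠ none ∧ ((((i = 0 ∨ w[i - 1]? ≠ none) ∧ some b = c)) ∨
          (¬ (i = 0 ∨ w[i - 1]? ≠ none) ∧ none = c))) := by
  rcases lt_trichotomy i w.length with h | h | h
  · rw [List.getElem?_append_left h, List.getElem?_eq_getElem h]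
    simp
  · subst h
    by_cases hw : w.length = 0
    · simp [hw]
    · have : w[w.length - 1]? ≠ none := by
        rw [List.getElem?_eq_getElem (by omega)]
        simp
      rw [List.getElem?_concat_length, List.getElem?_eq_none le_rfl]
      simp only [ne_eq, not_true, false_and, not_false_iff, true_and, false_or, this, or_true]
      simp
  · rw [List.getElem?_eq_none (l := w ++ [b]) (by simp; omega), List.getElem?_eq_none h.le,
      List.getElem?_eq_none (by omega)]
    simp [show i ≠ 0 by omega]

lemma Dec.letter_concat (h : ∀ (i : ℕ) (c : Option Bool), Dec φ N S a (fun ω => (w ω)[i]? = c)) (b : Bool) (i : ℕ)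
    (c : Option Bool) : Dec φ N S (a + 6) (fun ω => (w ω ++ [b])[i]? = c) := by
  have h1 : Dec φ N S (a + 2) fun ω => i = 0 ∨ (w ω)[i - 1]? ≠ none :=
    Eff.or (Dec.const (d := 0) _) ((h (i - 1) none).not (lt_add_one a)) (by omega) (by omega)
  refine (Eff.ite (d := a + 6) ((h i none).not (lt_add_one a)) (h i c)
    (Eff.ite (d := a + 4) h1 (Dec.const (d := 0) (some b = c)) (Dec.const (d := 0) (none = c))
      (by omega) (by omega) (by omega)) (by omega) (by omega) (by omega)).congr fun ω => ?_
  rw [getElem?_concat_eq]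

/-! #### Addition modulo `p` -/

/-- There is a carry into position `i` when `v` and `e` are added. -/
def Carry (v e i : ℕ) : Prop := 2 ^ i ≤ v % 2 ^ i + e % 2 ^ i

lemma mod_two_pow_succ' (v i : ℕ) :
    v % 2 ^ (i + 1) = v % 2 ^ i + 2 ^ i * (v.testBit i).toNat := by
  rw [pow_succ, Nat.mod_mul, Nat.toNat_testBit]

/-- The recursion of a ripple-carry adder: the carry is the majority of both bits and the preceding
carry. -/
lemma carry_succ (v e i : ℕ) :
    Carry v e (i + 1) ↔ (v.testBit i = true ∧ e.testBit i = true) ∨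
      ((v.testBit i = true ∨ e.testBit i = true) ∧ Carry v e i) := by
  have h1 : v % 2 ^ i < 2 ^ i := Nat.mod_lt _ (by positivity)
  have h2 : e % 2 ^ i < 2 ^ i := Nat.mod_lt _ (by positivity)
  have h3 : 2 ^ (i + 1) = 2 * 2 ^ i := by ring
  rw [Carry, Carry, mod_two_pow_succ' v i, mod_two_pow_succ' e i, h3]
  cases v.testBit i <;> cases e.testBit i <;>
    simp only [Bool.toNat_false, Bool.toNat_true, mul_zero, mul_one] <;> simp <;> omega

lemma testBit_add_iff (v e i : ℕ) :
    (v + e).testBit i = true ↔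
      Xor (Xor (v.testBit i = true) (e.testBit i = true)) (Carry v e i) := by
  have h1 : v % 2 ^ i < 2 ^ i := Nat.mod_lt _ (by positivity)
  have h2 : e % 2 ^ i < 2 ^ i := Nat.mod_lt _ (by positivity)
  have h3 : 2 ^ (i + 1) = 2 * 2 ^ i := by ring
  have h4 : (v + e) % 2 ^ i = (v % 2 ^ i + e % 2 ^ i) % 2 ^ i := Nat.add_mod _ _ _
  have h5 : (v + e) % 2 ^ (i + 1) = (v % 2 ^ (i + 1) + e % 2 ^ (i + 1)) % 2 ^ (i + 1) :=
    Nat.add_mod _ _ _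
  rw [mod_two_pow_succ' (v + e) i, mod_two_pow_succ' v i, mod_two_pow_succ' e i, h4, h3] at h5
  -- Two residues and a carry stay below `4 * 2 ^ i`, so the modulus `2 * 2 ^ i` is subtracted at
  -- most once.
  have key : ∀ X Y : ℕ, Y = X % (2 * 2 ^ i) → X < 4 * 2 ^ i →
      (Y = X ∧ X < 2 * 2 ^ i) ∨ (Y + 2 * 2 ^ i = X) := by
    intro X Y h h'
    rcases lt_or_ge X (2 * 2 ^ i) with h'' | h''
    · exact .inl ⟨by rw [h, Nat.mod_eq_of_lt h''], h''⟩
    · rw [Nat.mod_eq_sub_mod h'', Nat.mod_eq_of_lt (by omega)] at h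
      omega
  by_cases hc : Carry v e i <;> have hc' := hc <;> rw [Carry] at hc'
  · rw [Nat.mod_eq_sub_mod hc', Nat.mod_eq_of_lt (by omega)] at h5
    revert h5
    simp only [hc, Xor]
    cases v.testBit i <;> cases e.testBit i <;> cases (v + e).testBit i <;>
      simp only [Bool.toNat_false, Bool.toNat_true, mul_zero, mul_one] <;> intro h5 <;>
      have h6 := key _ _ h5 (by omega) <;> clear h5 <;> first | (simp; done) | (exfalso; omega)
  · rw [Nat.mod_eq_of_lt (not_le.1 hc')] at h5
    revert h5
    simp only [hc, Xor]
    cases v.testBit i <;> cases e.testBit i <;> cases (v + e).testBit i <;>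
      simp only [Bool.toNat_false, Bool.toNat_true, mul_zero, mul_one] <;> intro h5 <;>
      have h6 := key _ _ h5 (by omega) <;> clear h5 <;> first | (simp; done) | (exfalso; omega)

/-- The lowest `n` bits of a number. -/
def bitObs (n : ℕ) : List (ℕ → Prop) := (List.range n).map fun b v => v.testBit b = true

lemma mem_bitObs {n b : ℕ} (h : b < n) : (fun v : ℕ => v.testBit b = true) ∈ bitObs n :=
  List.mem_map.2 ⟨b, List.mem_range.2 h, rfl⟩

variable {v : Ω → ℕ}

/-- Each carry is obtained from the preceding one by a single gate, the bits of `e` being constants;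
the cost is linear in `i`. -/
lemma Dec.carry {D : ℕ} (hD : D ≤ N) (hv : S4.obs (bitObs D) v ⊆ S) (e i : ℕ) (hi : i ≤ D) :
    Dec φ N S 1 (fun ω => Carry (v ω) e i) := by
  have key : Builds φ S (i + 1) {fun ω => Carry (v ω) e i} := by
    induction i with
    | zero => exact .mono (.const False) le_rfl (by simp [Carry, Nat.mod_one])
    | succ i ih =>
      refine ((ih (by omega)).bind (.gate (fun x y => (x ∧ e.testBit i = true) ∨
        ((x ∨ e.testBit i = true) ∧ y)) (p := fun ω => (v ω).testBit i = true)
        (q := fun ω => Carry (v ω) e i) (.inl (hv (mem_obs (mem_bitObs (by omega)) v)))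
        (.inr rfl))).mono le_rfl ?_
      simp only [carry_succ]
      rfl
  exact key.mono (by rw [pow_one]; omega) le_rfl

lemma Dec.testBit_add {D : ℕ} (hD : D ≤ N) (hv : S4.obs (bitObs D) v ⊆ S) (e i : ℕ) (hi : i < D) :
    Dec φ N S 2 (fun ω => (v ω + e).testBit i = true) := by
  refine (Eff.gate (d := 2) (fun x y => Xor (Xor x (e.testBit i = true)) y)
    (Dec.of_mem (d := 0) (hv (mem_obs (mem_bitObs hi) v))) (Dec.carry hD hv e i hi.le)
    (by omega) (by omega)).congr fun ω => ?_
  rw [testBit_add_iff]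

/-- Reduction modulo `p` without a separate comparison: adding `c + 2 ^ D - p` overflows `D` bits
exactly when `p ≤ y + c`, and the low `D` bits are then those of `y + c - p`. -/
lemma zmod_val_add_testBit {p D : ℕ} [NeZero p] (hp : p ≤ 2 ^ D) (y c : ZMod p) (i : ℕ)
    (hi : i < D) :
    (y + c).val.testBit i = true ↔
      (Carry y.val (c.val + 2 ^ D - p) D ∧ (y.val + (c.val + 2 ^ D - p)).testBit i = true) ∨
        (¬ Carry y.val (c.val + 2 ^ D - p) D ∧ (y.val + c.val).testBit i = true) := by
  have hy := y.val_lt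
  have hc := c.val_lt
  have h1 : Carry y.val (c.val + 2 ^ D - p) D ↔ p ≤ y.val + c.val := by
    rw [Carry, Nat.mod_eq_of_lt (by omega), Nat.mod_eq_of_lt (by omega)]
    omega
  rw [ZMod.val_add, h1]
  by_cases h : p ≤ y.val + c.val
  · rw [Nat.mod_eq_sub_mod h, Nat.mod_eq_of_lt (by omega)]
    simp only [h, true_and, not_true, false_and, or_false]
    rw [show y.val + (c.val + 2 ^ D - p) = 2 ^ D + (y.val + c.val - p) by omega,
      Nat.testBit_two_pow_add_gt hi]
  · rw [Nat.mod_eq_of_lt (by omega)]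
    simp [h]

lemma Eff.zmod_add {p D : ℕ} [NeZero p] (hp : p ≤ 2 ^ D) (hD : D ≤ N) {y : Ω → ZMod p}
    (hy : S4.obs (bitObs D) (fun ω => (y ω).val) ⊆ S) (hr : r ∈ S) (c : ZMod p) :
    open Classical in
    Eff φ N S 7 (S4.obs (bitObs D) fun ω => (y ω + if r ω then c else 0).val) := by
  refine Eff.of_forall (a := 6) (e := 1) (fun ψ hψ => ?_) (by simp [bitObs]; omega) (by omega)
  obtain ⟨i, hi, rfl⟩ := List.mem_map.1 hψ
  rw [List.mem_range] at hi
  refine (Eff.ite (d := 6) (Dec.of_mem (d := 0) hr) (Eff.ite (d := 4)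
    (Dec.carry hD hy (c.val + 2 ^ D - p) D le_rfl) (Dec.testBit_add hD hy (c.val + 2 ^ D - p) i hi)
    (Dec.testBit_add hD hy c.val i hi) (by omega) (by omega) (by omega))
    (Dec.of_mem (d := 0) (hy (mem_obs (mem_bitObs hi) _)))
    (by omega) (by omega) (by omega)).congr fun ω => ?_
  by_cases h : r ω
  · simp only [h, true_and, if_true, not_true, false_and, or_false]
    exact (zmod_val_add_testBit hp _ _ _ hi).symm
  · simp [h]

open Classical in
/-- The sum of selected constants. -/
lemma Eff.zmod_sum {p D : ℕ} [NeZero p] (hp : p ≤ 2 ^ D) (hD : D ≤ N)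
    (l : List ((Ω → Prop) × ZMod p)) (hl : ∀ u ∈ l, u.1 ∈ S) (he : l.length ≤ (N + 4) ^ e) :
    Eff φ N S (e + 8)
      (S4.obs (bitObs D) fun ω => (l.map fun u : (Ω → Prop) × ZMod p => if u.1 ω then u.2 else 0).sum.val) := by
  have key : Builds φ S (l.length * (N + 4) ^ 7 + (N + 4))
      (S4.obs (bitObs D) fun ω => (l.map fun u : (Ω → Prop) × ZMod p => if u.1 ω then u.2 else 0).sum.val) := by
    clear he
    induction l with
    | nil =>
      refine Builds.mono (c := 1) (.const False) (by simp) ?_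
      rintro _ ⟨ψ, hψ, rfl⟩
      obtain ⟨i, hi, rfl⟩ := List.mem_map.1 hψ
      simp
    | cons u l ih =>
      have h1 := ih fun u hu => hl u (by simp [hu])
      -- Only the bits of the running sum are passed on, so each summand costs one adder.
      refine (h1.bind (Eff.zmod_add hp hD Set.subset_union_right (.inl (hl u (by simp)))
        u.2)).mono (le_of_eq (by rw [List.length_cons]; ring)) (le_of_eq ?_)
      simp [add_comm]
  refine key.mono ?_ le_rfl
  have h1 : 1 ≤ (N + 4) ^ e := Nat.one_le_pow _ _ (by omega)
  have h2 : (N + 4) ≤ (N + 4) ^ 7 := Nat.le_self_pow (by omega) _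
  calc l.length * (N + 4) ^ 7 + (N + 4) ≤ (N + 4) ^ e * (N + 4) ^ 7 + (N + 4) ^ e * (N + 4) ^ 7 := by
        gcongr
        nlinarith
    _ ≤ (N + 4) ^ e * (N + 4) ^ 7 * (N + 4) := by nlinarith [Nat.zero_le ((N + 4) ^ e * (N + 4) ^ 7)]
    _ = (N + 4) ^ (e + 8) := by ring

end Eff

/-! ### Circuits for the computations of Turing machines -/

namespace Machine

variable {T : Machine}

/-- The effect of an instruction. -/
def stepInstr (I : Instr T.tapes T.states) (coin : Bool) (ans : List Bool) (c : T.Cfg) : T.Cfg :=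
  match I with
  | .work i next =>
    let x := next (c.work i).head
    let t := (c.work i).write x.1
    { c with
      state := x.2.2
      work := Function.update c.work i (x.2.1.elim t (fun d => t.move d)) }
  | .write a next => { c with state := next, query := c.query ++ [a] }
  | .read next => { c with state := next c.answer.head?, answer := c.answer.tail }
  | .ask next => { c with state := next, query := [], answer := ans }
  | .toss next => { c with state := next coin }
  | .halt _ => c

/-- Separates the instruction from the configuration, so that it can be held fixed while the
configuration varies. -/
lemma stepWith_eq (coin : Bool) (ans : List Bool) (c : T.Cfg) :
    stepWith coin ans c = stepInstr (T.instr c.state) coin ans c := rfl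

/-- The work tapes are blank beyond distance `n`, and the query has length at most `n`. -/
structure Cfg.Within (c : T.Cfg) (n : ℕ) : Prop where
  work : ∀ i j, (n : ℤ) < |j| → (c.work i).nth j = none
  query : c.query.length ≤ n

lemma within_initial (input : List Bool) : (T.initial input).Within 0 := by
  refine ⟨fun i j _ => ?_, le_rfl⟩
  change (default : Turing.Tape (Option Bool)).nth j = none
  rcases j with (_ | j) | j <;> simp [Turing.Tape.nth] <;> rfl

/-- The offset of the cells after a movement of the head. -/
def offset : Option Turing.Dir → ℤ
  | none => 0
  | some .left => -1
  | some .right => 1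

/-- Cells are numbered relative to the head, so a movement renumbers all cells of the tape. -/
lemma nth_write_move (t : Turing.Tape (Option Bool)) (b : Option Bool) (d : Option Turing.Dir)
    (j : ℤ) :
    (d.elim (t.write b) (fun d => (t.write b).move d)).nth j
      = if j + offset d = 0 then b else t.nth (j + offset d) := by
  rcases d with _ | _ | _ <;> (simp [offset, Turing.Tape.write_nth, ← sub_eq_add_neg]; try rfl)

lemma abs_offset_le (d : Option Turing.Dir) : |offset d| ≤ 1 := by
  rcases d with _ | _ | _ <;> simp [offset]

lemma Cfg.Within.step {c : T.Cfg} {n : ℕ} (h : c.Within n) (coin : Bool) (ans : List Bool) :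
    (stepWith coin ans c).Within (n + 1) := by
  have h1 : ∀ i j, ((n + 1 : ℕ) : ℤ) < |j| → (c.work i).nth j = none := fun i j hj =>
    h.work i j (by push_cast at hj; omega)
  have h2 := h.query
  rw [stepWith_eq]
  rcases T.instr c.state with ⟨i, next⟩ | ⟨a, next⟩ | next | next | next | a
  · refine ⟨fun i' j hj => ?_, by simp only [stepInstr]; omega⟩
    simp only [stepInstr]
    by_cases e : i' = i
    · subst e
      rw [Function.update_self, nth_write_move]
      have h3 := abs_offset_le (next (c.work i').head).2.1
      have h4 := abs_sub_abs_le_abs_sub j (-offset (next (c.work i').head).2.1)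
      rw [abs_neg, sub_neg_eq_add] at h4
      push_cast at hj
      rw [if_neg, h.work i' _ (by omega)]
      intro h0
      rw [h0, abs_zero] at h4
      omega
    · rw [Function.update_of_ne e]
      exact h1 i' j hj
  · exact ⟨h1, by simp [stepInstr, h2]⟩
  · exact ⟨h1, by simp only [stepInstr]; omega⟩
  · exact ⟨h1, by simp [stepInstr]⟩
  · exact ⟨h1, by simp only [stepInstr]; omega⟩
  · exact ⟨h1, by simp only [stepInstr]; omega⟩

lemma length_answer_stepWith {c : T.Cfg} {n : ℕ} (h : c.answer.length ≤ n) (coin : Bool)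
    {ans : List Bool} (ha : ans.length ≤ n) : (stepWith coin ans c).answer.length ≤ n := by
  rw [stepWith_eq]
  rcases T.instr c.state with ⟨i, next⟩ | ⟨a, next⟩ | next | next | next | a <;>
    simp only [stepInstr, List.length_tail] <;> omega

/-- The positions at distance at most `n`. -/
def cells (n : ℕ) : List ℤ := (List.range (2 * n + 1)).map fun a : ℕ => (a : ℤ) - n

lemma mem_cells {n : ℕ} {j : ℤ} : j ∈ cells n ↔ |j| ≤ n := by
  simp only [cells, List.mem_map, List.mem_range]
  constructor
  · rintro ⟨a, ha, rfl⟩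
    rw [abs_le]
    omega
  · intro h
    rw [abs_le] at h
    exact ⟨(j + n).toNat, by omega, by omega⟩

variable (T) in
/-- The contents of a configuration. -/
def cfgObs (n : ℕ) : List (T.Cfg → Prop) :=
  (eqs (List.finRange T.states)).map (fun ψ c => ψ c.state) ++
  ((List.finRange T.tapes).flatMap fun i => (cells n).flatMap fun j =>
    (eqs letters).map fun ψ c => ψ ((c.work i).nth j)) ++
  (wordObs n).map (fun ψ c => ψ c.query) ++
  (wordObs n).map (fun ψ c => ψ c.answer)

lemma length_cfgObs_le {N : ℕ} (hT : T.size ≤ N) : (cfgObs T N).length ≤ (N + 4) ^ 3 := by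
  rw [size] at hT
  have h : (cfgObs T N).length
      = T.states + T.tapes * ((2 * N + 1) * 3) + N * 3 + N * 3 := by
    simp [cfgObs, length_wordObs, List.length_flatMap, letters, cells, Function.comp_def]
    ring
  rw [h]
  have h1 : T.tapes ≤ N := by omega
  have h2 : T.states ≤ N := by omega
  calc _ ≤ N + N * ((2 * N + 1) * 3) + N * 3 + N * 3 := by gcongr
    _ ≤ _ := by ring_nf; nlinarith [Nat.zero_le (N ^ 3)]

lemma mem_cfgObs {n : ℕ} {ψ : T.Cfg → Prop} :
    ψ ∈ cfgObs T n ↔ (∃ q, ψ = fun c => c.state = q) ∨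
      (∃ i j, |j| ≤ (n : ℤ) ∧ ∃ a, ψ = fun c => (c.work i).nth j = a) ∨
      (∃ i < n, ∃ a, ψ = fun c => c.query[i]? = a) ∨
      (∃ i < n, ∃ a, ψ = fun c => c.answer[i]? = a) := by
  simp only [cfgObs, List.mem_append, List.mem_flatMap, List.mem_map, eqs, List.mem_finRange,
    true_and, mem_cells, mem_wordObs, or_assoc]
  refine or_congr ⟨?_, ?_⟩ (or_congr ⟨?_, ?_⟩ (or_congr ⟨?_, ?_⟩ ⟨?_, ?_⟩))
  · rintro ⟨_, ⟨q, rfl⟩, rfl⟩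
    exact ⟨q, rfl⟩
  · rintro ⟨q, rfl⟩
    exact ⟨_, ⟨q, rfl⟩, rfl⟩
  · rintro ⟨i, j, hj, _, ⟨a, -, rfl⟩, rfl⟩
    exact ⟨i, j, hj, a, rfl⟩
  · rintro ⟨i, j, hj, a, rfl⟩
    exact ⟨i, j, hj, _, ⟨a, mem_letters a, rfl⟩, rfl⟩
  · rintro ⟨_, ⟨i, hi, a, rfl⟩, rfl⟩
    exact ⟨i, hi, a, rfl⟩
  · rintro ⟨i, hi, a, rfl⟩
    exact ⟨_, ⟨i, hi, a, rfl⟩, rfl⟩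
  · rintro ⟨_, ⟨i, hi, a, rfl⟩, rfl⟩
    exact ⟨i, hi, a, rfl⟩
  · rintro ⟨i, hi, a, rfl⟩
    exact ⟨_, ⟨i, hi, a, rfl⟩, rfl⟩

end Machine

/-! ### Circuits for a step and for a run of a machine -/

section Eff

open Machine

variable {Ω : Type} {φ : Ω → List Bool → List Bool} {N : ℕ} {S : Set (Ω → Prop)} {a d : ℕ}
  {T : Machine} {c : Ω → T.Cfg} {ans input : Ω → List Bool}

variable (φ N S) in
/-- The contents of the configuration `c` are computable, and within bounds. -/
structure EffCfg (a : ℕ) (c : Ω → T.Cfg) : Prop where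
  state : ∀ q, Dec φ N S a fun ω => (c ω).state = q
  work : ∀ i j b, Dec φ N S a fun ω => ((c ω).work i).nth j = b
  query : ∀ (i : ℕ) (b : Option Bool), Dec φ N S a fun ω => (c ω).query[i]? = b
  answer : ∀ (i : ℕ) (b : Option Bool), Dec φ N S a fun ω => (c ω).answer[i]? = b

/-- Outside the bounds all cells and letters are blank, hence constant: finitely many observables
determine the contents at every position. -/
lemma Eff.effCfg (h : Eff φ N S a (obs (cfgObs T N) c)) (h1 : ∀ ω, (c ω).Within N)
    (h2 : ∀ ω, (c ω).answer.length ≤ N) : EffCfg φ N S a c where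
  state q := h.dec (ψ := fun c => c.state = q) (mem_cfgObs.2 (.inl ⟨q, rfl⟩))
  work i j b := by
    by_cases hj : |j| ≤ (N : ℤ)
    · exact h.dec (ψ := fun c => (c.work i).nth j = b) (mem_cfgObs.2 (.inr (.inl ⟨i, j, hj, b, rfl⟩)))
    · exact (Dec.const (none = b)).congr fun ω => by rw [(h1 ω).work i j (by omega)]
  query i b := by
    by_cases hi : i < N
    · exact h.dec (ψ := fun c : T.Cfg => c.query[i]? = b)
        (mem_cfgObs.2 (.inr (.inr (.inl ⟨i, hi, b, rfl⟩))))
    · exact (Dec.const (none = b)).congr fun ω => by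
        rw [List.getElem?_eq_none (by have := (h1 ω).query; omega)]
  answer i b := by
    by_cases hi : i < N
    · exact h.dec (ψ := fun c : T.Cfg => c.answer[i]? = b)
        (mem_cfgObs.2 (.inr (.inr (.inr ⟨i, hi, b, rfl⟩))))
    · exact (Dec.const (none = b)).congr fun ω => by
        rw [List.getElem?_eq_none (by have := (h2 ω); omega)]

lemma EffCfg.eff (h : EffCfg φ N S a c) (hT : T.size ≤ N) (hd : a + 3 ≤ d) :
    Eff φ N S d (obs (cfgObs T N) c) := by
  refine Eff.of_forall (fun ψ hψ => ?_) (length_cfgObs_le hT) hd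
  rcases mem_cfgObs.1 hψ with ⟨q, rfl⟩ | ⟨i, j, -, b, rfl⟩ | ⟨i, -, b, rfl⟩ | ⟨i, -, b, rfl⟩
  exacts [h.state q, h.work i j b, h.query i b, h.answer i b]

lemma Dec.letter_cases {x : Ω → Option Bool} {p : Option Bool → Ω → Prop}
    (hx : ∀ y, Dec φ N S a (fun ω => x ω = y)) (h : ∀ y, Dec φ N S a (p y)) :
    Dec φ N S (a + 3) (fun ω => p (x ω) ω) :=
  Dec.cases x letters (e := 1) (fun y _ => hx y) (fun y _ => h y) (by simp [letters])
    (fun ω h => absurd (mem_letters _) h) (by omega) (by omega)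

lemma EffCfg.stepInstr (h : EffCfg φ N S a c)
    (ha : ∀ (i : ℕ) (b : Option Bool), Dec φ N S a fun ω => (ans ω)[i]? = b)
    (coin : Bool) (I : Instr T.tapes T.states) :
    EffCfg φ N S (a + 6) fun ω => stepInstr I coin (ans ω) (c ω) := by
  have hstate := fun q => (h.state q).le (show a ≤ a + 6 by omega)
  have hwork := fun i j b => (h.work i j b).le (show a ≤ a + 6 by omega)
  have hquery := fun i b => (h.query i b).le (show a ≤ a + 6 by omega)
  have hanswer := fun i b => (h.answer i b).le (show a ≤ a + 6 by omega)
  rcases I with ⟨i, next⟩ | ⟨b, next⟩ | next | next | next | b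
  · refine ⟨fun q => ?_, fun i' j b => ?_, hquery, hanswer⟩
    · exact (Dec.letter_cases (p := fun y _ => (next y).2.2 = q) (h.work i 0)
        fun y => Dec.const _).le (by omega)
    · by_cases e : i' = i
      · subst e
        refine ((Dec.letter_cases (p := fun y ω =>
          (if j + offset (next y).2.1 = 0 then (next y).1
            else ((c ω).work i').nth (j + offset (next y).2.1)) = b) (h.work i' 0)
          fun y => ?_).le (show a + 3 ≤ a + 6 by omega)).congr fun ω => ?_
        · by_cases e : j + offset (next y).2.1 = 0
          · simpa only [e, if_true] using Dec.const _
          · simpa only [e, if_false] using h.work i' _ b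
        · simp only [Machine.stepInstr, Function.update_self]
          rw [nth_write_move]
          rfl
      · simpa only [Machine.stepInstr, Function.update_of_ne e] using hwork i' j b
  · exact ⟨fun q => Dec.const (next = q), hwork, Dec.letter_concat h.query b, hanswer⟩
  · refine ⟨fun q => ?_, hwork, hquery, fun i b => ?_⟩
    · simpa only [Machine.stepInstr, List.head?_eq_getElem?] using
        (Dec.letter_cases (p := fun y _ => next y = q) (h.answer 0)
        fun y => Dec.const _).le (by omega)
    · simpa only [Machine.stepInstr, List.getElem?_tail] using hanswer (i + 1) b
  · exact ⟨fun q => Dec.const (next = q), hwork, fun i b => Dec.const (([] : List Bool)[i]? = b),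
      fun i b => (ha i b).le (by omega)⟩
  · exact ⟨fun q => Dec.const (next coin = q), hwork, hquery, hanswer⟩
  · exact ⟨hstate, hwork, hquery, hanswer⟩

/-- Case distinction over the control state; in each case the instruction is a constant. -/
lemma EffCfg.stepWith (h : EffCfg φ N S a c) (hT : T.size ≤ N)
    (ha : ∀ (i : ℕ) (b : Option Bool), Dec φ N S a fun ω => (ans ω)[i]? = b) (coin : Bool) :
    EffCfg φ N S (a + 9) fun ω => stepWith coin (ans ω) (c ω) := by
  have key : ∀ ψ : T.Cfg → Prop,
      (∀ q, Dec φ N S (a + 6) fun ω => ψ (Machine.stepInstr (T.instr q) coin (ans ω) (c ω))) →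
      Dec φ N S (a + 9) fun ω => ψ (Machine.stepWith coin (ans ω) (c ω)) := fun ψ hψ =>
    Dec.cases (fun ω => (c ω).state) (List.finRange T.states) (e := 1)
      (p := fun q ω => ψ (Machine.stepInstr (T.instr q) coin (ans ω) (c ω)))
      (fun q _ => h.state q) (fun q _ => hψ q) (by simp; rw [size] at hT; omega)
      (fun ω hω => absurd (List.mem_finRange _) hω) (by omega) (by omega)
  have hI := fun q => h.stepInstr ha coin (T.instr q)
  exact ⟨fun q => key (fun c => c.state = q) fun q' => (hI q').state q,
    fun i j b => key (fun c => (c.work i).nth j = b) fun q' => (hI q').work i j b,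
    fun i b => key (fun c : T.Cfg => c.query[i]? = b) fun q' => (hI q').query i b,
    fun i b => key (fun c => c.answer[i]? = b) fun q' => (hI q').answer i b⟩

lemma EffCfg.initial
    (h : ∀ (i : ℕ) (b : Option Bool), Dec φ N S a fun ω => (input ω)[i]? = b) :
    EffCfg φ N S a fun ω => T.initial (input ω) where
  state q := Dec.const (T.start = q)
  work _ j b := Dec.const ((default : Turing.Tape (Option Bool)).nth j = b)
  query i b := Dec.const (([] : List Bool)[i]? = b)
  answer := h

lemma Machine.within_runWith (coins : ℕ → Bool) (answers : ℕ → List Bool) (u : List Bool) (t : ℕ) :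
    (runWith coins answers (T.initial u) t).Within t := by
  induction t with
  | zero => exact within_initial _
  | succ t ih => exact ih.step _ _

/-- The word that a machine leaves on its query tape can be computed. -/
lemma Eff.runWith_query (hT : T.size ≤ N) (hl : ∀ ω, (input ω).length ≤ N)
    (h : ∀ (i : ℕ) (b : Option Bool), Dec φ N S a fun ω => (input ω)[i]? = b) (t : ℕ)
    (ht : t ≤ N) (hd : max (a + 4) 14 ≤ d) (i : ℕ) (b : Option Bool) :
    Dec φ N S d fun ω =>
      (runWith (fun _ => false) (fun _ => []) (T.initial (input ω)) t).query[i]? = b := by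
  have h2 : ∀ t ω,
      (runWith (fun _ => false) (fun _ => []) (T.initial (input ω)) t).answer.length ≤ N := by
    intro t ω
    induction t with
    | zero => exact hl ω
    | succ t ih => exact length_answer_stepWith ih _ (by simp)
  have h1' : ∀ t ≤ N, ∀ ω,
      (runWith (fun _ => false) (fun _ => []) (T.initial (input ω)) t).Within N := fun t ht ω =>
    ⟨fun i j hj => (within_runWith _ _ _ t).work i j (by omega),
      (within_runWith _ _ _ t).query.trans ht⟩
  -- From the observables of one configuration, a step costs 9 in the exponent and listing the new
  -- observables 3; the at most `N` repetitions add 1.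
  have h3 := Eff.iterate (φ := φ) (N := N) (a := 12) (e := 1) (d := 13)
    (T := fun t => obs (cfgObs T N) fun ω =>
      runWith (fun _ => false) (fun _ => []) (T.initial (input ω)) t) t (fun u hu =>
      ((Eff.effCfg (a := 0) (Eff.of_subset le_rfl) (h1' u (by omega)) (h2 u)).stepWith
        (ans := fun _ => []) hT (fun i b => Dec.const _) false).eff hT le_rfl)
      (by rw [pow_one]; omega) le_rfl
  have h4 := (EffCfg.initial (T := T) h).eff hT le_rfl
  exact (h4.bind (h3.left Set.subset_union_right) (by omega) (by omega)).effCfg (h1' t ht) (h2 t)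
    |>.query i b

end Eff

/-! ### Circuits for the arithmetic of blocks -/

namespace Params

lemma testBit_toNumber (w : List Bool) (b : ℕ) :
    (toNumber w).testBit b = true ↔ w[b]? = some true := by
  induction w generalizing b with
  | nil => simp [toNumber]
  | cons c w ih =>
    have h : toNumber (c :: w) = c.toNat + 2 * toNumber w := by
      simp [toNumber, Nat.ofDigits_cons]
    rw [h]
    rcases b with _ | b
    · cases c <;> simp [Nat.testBit_zero]
    · rw [Nat.testBit_add_one, List.getElem?_cons_succ, ← ih]
      have h2 : (c.toNat + 2 * toNumber w) / 2 = toNumber w := by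
        cases c
        · simp
        · simp only [Bool.toNat_true]
          omega
      rw [h2]

lemma toNumber_lt (w : List Bool) : toNumber w < 2 ^ w.length := by
  refine Nat.lt_pow_two_of_testBit _ fun i hi => ?_
  have h := testBit_toNumber w i
  rw [List.getElem?_eq_none hi] at h
  simpa using h

variable {k : ℕ} (P : Params k)

instance : NeZero P.p := ⟨P.prime.out.ne_zero⟩

lemma p_le : P.p ≤ 2 ^ P.digitBits := Nat.le_pow_clog (by norm_num) _

lemma val_lt (z : ZMod P.p) : z.val < 2 ^ P.digitBits := z.val_lt.trans_le P.p_le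

/-- The bits of a field element. -/
def elemObs : List (P.K → Prop) :=
  (List.finRange P.e).flatMap fun a => List.ofFn fun i : Fin P.digitBits =>
    fun x => (P.basis.repr x a).val.testBit i = true

/-- The bits of a block. -/
def blockObs : List (P.Block → Prop) :=
  (List.finRange P.n).flatMap fun i => P.elemObs.map fun ψ v => ψ (v i)

open Classical in
lemma encodeElem_eq (x : P.K) : P.encodeElem x = P.elemObs.map fun ψ => decide (ψ x) := by
  simp only [encodeElem, elemObs, List.map_flatMap, List.map_ofFn, Function.comp_def,
    Bool.decide_eq_true]

open Classical in
lemma encodeBlock_eq (v : P.Block) : P.encodeBlock v = P.blockObs.map fun ψ => decide (ψ v) := by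
  simp only [encodeBlock, blockObs, List.map_flatMap, List.map_map, Function.comp_def,
    encodeElem_eq]

lemma length_elemObs : P.elemObs.length = P.elemBits := by
  simp [elemObs, List.length_flatMap, elemBits]

lemma length_blockObs : P.blockObs.length = P.blockBits := by
  simp [blockObs, List.length_flatMap, blockBits, length_elemObs]

lemma length_encodeBlock (v : P.Block) : (P.encodeBlock v).length = P.blockBits := by
  rw [encodeBlock_eq, List.length_map, length_blockObs]

lemma mem_elemObs {ψ : P.K → Prop} :
    ψ ∈ P.elemObs ↔ ∃ a, ∃ b < P.digitBits,
      ψ = fun x => (P.basis.repr x a).val.testBit b = true := by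
  simp only [elemObs, List.mem_flatMap, List.mem_finRange, true_and, List.mem_ofFn]
  constructor
  · rintro ⟨a, i, rfl⟩
    exact ⟨a, i, i.2, rfl⟩
  · rintro ⟨a, b, hb, rfl⟩
    exact ⟨a, ⟨b, hb⟩, rfl⟩

lemma mem_blockObs {ψ : P.Block → Prop} :
    ψ ∈ P.blockObs ↔ ∃ i a, ∃ b < P.digitBits,
      ψ = fun v => (P.basis.repr (v i) a).val.testBit b = true := by
  simp only [blockObs, List.mem_flatMap, List.mem_finRange, true_and, List.mem_map, mem_elemObs]
  constructor
  · rintro ⟨i, _, ⟨a, b, hb, rfl⟩, rfl⟩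
    exact ⟨i, a, b, hb, rfl⟩
  · rintro ⟨i, a, b, hb, rfl⟩
    exact ⟨i, _, ⟨a, b, hb, rfl⟩, rfl⟩

lemma take_drop_flatMap {α β : Type*} {D : ℕ} (g : α → List β) (l : List α)
    (h : ∀ x, (g x).length = D) (i : ℕ) (hi : i < l.length) :
    ((l.flatMap g).drop (i * D)).take D = g l[i] := by
  induction l generalizing i with
  | nil => simp at hi
  | cons x l ih =>
    rcases i with _ | i
    · simp [← h x]
    · rw [List.flatMap_cons, show (i + 1) * D = (g x).length + i * D by rw [h]; ring,
        List.drop_length_add_append]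
      simpa using ih i (by simpa using hi)

lemma toNumber_ofFn {D v : ℕ} (hv : v < 2 ^ D) :
    toNumber (List.ofFn fun i : Fin D => v.testBit i) = v := by
  refine Nat.eq_of_testBit_eq fun b => Bool.eq_iff_iff.2 ?_
  rw [testBit_toNumber, List.getElem?_ofFn]
  split_ifs with h
  · simp
  · simp [Nat.testBit_eq_false_of_lt (hv.trans_le (Nat.pow_le_pow_right (by omega) (not_lt.1 h)))]

/-- The permutation oracle decodes its query, so this is what makes a query with the encoding of `x`
return the encoding of `f x`. -/
lemma decodeElem_encodeElem (x : P.K) : P.decodeElem (P.encodeElem x) = x := by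
  conv_rhs => rw [← P.basis.sum_repr x]
  rw [decodeElem]
  refine Finset.sum_congr rfl fun a _ => ?_
  rw [encodeElem, take_drop_flatMap _ _ (by simp) _ (by simp)]
  simp only [List.getElem_finRange, Fin.cast_mk, Fin.eta]
  rw [toNumber_ofFn (P.val_lt _), ZMod.natCast_zmod_val]

end Params

/-! ### Block arithmetic as sums of selected constants -/

section Eff

open Params

variable {Ω : Type} {φ : Ω → List Bool → List Bool} {N : ℕ} {S : Set (Ω → Prop)} {a d e m : ℕ}

lemma Dec.letter_of_map {w : Ω → List Bool} (L : List (Ω → Prop)) (hL : ∀ p ∈ L, Dec φ N S a p)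
    (hw : ∀ ω, List.Forall₂ (fun p b => p ω ↔ b = true) L (w ω)) (i : ℕ) (c : Option Bool) :
    Dec φ N S (a + 1) fun ω => (w ω)[i]? = c := by
  by_cases hi : i < L.length
  · refine ((hL _ (L.getElem_mem hi)).gate (d := a + 1) (fun x _ => (some true = c ∧ x) ∨
      (some false = c ∧ ¬ x)) (hL _ (L.getElem_mem hi)) (by omega) (by omega)).congr fun ω => ?_
    have h1 := (hw ω).length_eq
    have h2 := (hw ω).get (i := i) hi (by omega)
    simp only [List.get_eq_getElem] at h2
    rw [List.getElem?_eq_getElem (by omega), h2]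
    cases (w ω)[i] <;> simp
  · refine (Dec.const (none = c)).congr fun ω => ?_
    rw [List.getElem?_eq_none]
    rw [← (hw ω).length_eq]
    omega

variable (φ N S) in
/-- The function `x` is the sum of `m` constants that are selected by predicates. -/
def SumOf {G : Type*} [AddCommMonoid G] (a m : ℕ) (x : Ω → G) : Prop :=
  ∃ l : List ((Ω → Prop) × G), (∀ u ∈ l, Dec φ N S a u.1) ∧ l.length ≤ m ∧
    ∀ ω, x ω = (l.map fun u : (Ω → Prop) × G =>
      open Classical in if u.1 ω then u.2 else 0).sum

namespace SumOf

variable {G H : Type*} [AddCommMonoid G] [AddCommMonoid H] {x y : Ω → G}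

lemma mono (h : SumOf φ N S a m x) {m' : ℕ} (hm : m ≤ m') : SumOf φ N S a m' x := by
  obtain ⟨l, h1, h2, h3⟩ := h
  exact ⟨l, h1, h2.trans hm, h3⟩

lemma congr (h : SumOf φ N S a m x) (hxy : ∀ ω, x ω = y ω) : SumOf φ N S a m y := by
  rwa [← show x = y from funext hxy]

open Classical in
lemma single {p : Ω → Prop} (hp : Dec φ N S a p) (c : G) :
    SumOf φ N S a 1 (fun ω => if p ω then c else 0) :=
  ⟨[(p, c)], by simpa using hp, by simp, by simp⟩

lemma add {m' : ℕ} (hx : SumOf φ N S a m x) (hy : SumOf φ N S a m' y) :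
    SumOf φ N S a (m + m') fun ω => x ω + y ω := by
  obtain ⟨l, h1, h2, h3⟩ := hx
  obtain ⟨l', h1', h2', h3'⟩ := hy
  refine ⟨l ++ l', ?_, by simp; omega, by simp [h3, h3']⟩
  intro u hu
  rcases List.mem_append.1 hu with hu | hu
  exacts [h1 u hu, h1' u hu]

/-- The purpose of `SumOf`: an additive map acts on the constants alone, so multiplication by a
fixed matrix is free of cost. -/
lemma map (hx : SumOf φ N S a m x) (g : G →+ H) : SumOf φ N S a m fun ω => g (x ω) := by
  obtain ⟨l, h1, h2, h3⟩ := hx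
  refine ⟨l.map fun u => (u.1, g u.2), ?_, by simpa, fun ω => ?_⟩
  · intro u hu
    obtain ⟨v, hv, rfl⟩ := List.mem_map.1 hu
    exact h1 v hv
  · simp only [h3]
    rw [map_list_sum, List.map_map, List.map_map]
    congr 1
    refine List.map_congr_left fun u _ => ?_
    simp only [Function.comp]
    split_ifs <;> simp

lemma list_sum {ι : Type*} (l : List ι) {x : ι → Ω → G} (h : ∀ i ∈ l, SumOf φ N S a m (x i)) :
    SumOf φ N S a (l.length * m) fun ω => (l.map fun i => x i ω).sum := by
  induction l with
  | nil => exact ⟨[], by simp, by simp, by simp⟩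
  | cons i l ih =>
    refine (((h i (by simp)).add (ih fun j hj => h j (by simp [hj]))).mono ?_).congr (by simp)
    rw [List.length_cons]
    exact le_of_eq (by ring)

lemma sum {n : ℕ} {x : Fin n → Ω → G} (h : ∀ i, SumOf φ N S a m (x i)) :
    SumOf φ N S a (n * m) fun ω => ∑ i, x i ω := by
  refine ((list_sum (List.finRange n) fun i _ => h i).mono (by simp)).congr fun ω => ?_
  rw [Fin.sum_univ_def]

end SumOf

lemma mod_two_pow_eq_sum (v D : ℕ) :
    v % 2 ^ D = ((List.range D).map fun b => if v.testBit b = true then 2 ^ b else 0).sum := by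
  induction D with
  | zero => simp [Nat.mod_one]
  | succ D ih =>
    rw [mod_two_pow_succ', ih, List.range_succ, List.map_append, List.sum_append]
    cases h : v.testBit D <;> simp [h]

lemma SumOf.natCast {R : Type*} [Ring R] {D : ℕ} {v : Ω → ℕ} (hv : ∀ ω, v ω < 2 ^ D)
    (h : ∀ b < D, Dec φ N S a fun ω => (v ω).testBit b = true) :
    SumOf φ N S a D fun ω => (v ω : R) := by
  refine ((SumOf.list_sum (List.range D) fun b hb =>
    SumOf.single (h b (List.mem_range.1 hb)) ((2 : R) ^ b)).mono (by simp)).congr fun ω => ?_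
  conv_rhs => rw [← Nat.mod_eq_of_lt (hv ω), mod_two_pow_eq_sum]
  rw [Nat.cast_list_sum, List.map_map]
  congr 1
  refine List.map_congr_left fun b _ => ?_
  simp only [Function.comp]
  split_ifs <;> simp

variable {k : ℕ} {P : Params k} {x y : Ω → P.Block}

/-- Assembling a block from its coordinates. -/
lemma SumOf.block {z : Fin P.n → Fin P.e → Ω → ZMod P.p} (h : ∀ i j, SumOf φ N S a m (z i j)) :
    SumOf φ N S a (P.n * (P.e * m)) fun ω i => ∑ j, z i j ω • P.basis j := by
  refine (SumOf.sum (x := fun i ω => ∑ j, Pi.single i (z i j ω • P.basis j)) fun i =>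
    SumOf.sum fun j => (h i j).map ((AddMonoidHom.single (fun _ : Fin P.n => P.K) i).comp
      (LinearMap.toSpanSingleton (ZMod P.p) P.K (P.basis j)).toAddMonoidHom)).congr fun ω => ?_
  funext i
  simp only [Finset.sum_apply, Pi.single_apply]
  rw [Finset.sum_eq_single i (fun j _ hj => by simp [hj.symm]) (by simp)]
  simp

/-- A block is a sum of fixed vectors selected by its bits: powers of two times basis elements,
placed in one entry. -/
lemma Sees.sumOf (h : Sees φ N S a P.blockObs x) : SumOf φ N S a P.blockBits x := by
  refine ((SumOf.block (z := fun i j ω => P.basis.repr (x ω i) j) fun i j =>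
    (SumOf.natCast (R := ZMod P.p) (v := fun ω => (P.basis.repr (x ω i) j).val) (fun ω => P.val_lt _)
      fun b hb => ?_).congr fun ω => ZMod.natCast_zmod_val _).mono (le_of_eq ?_)).congr fun ω => ?_
  · exact h (fun v : P.Block => (P.basis.repr (v i) j).val.testBit b = true)
      (P.mem_blockObs.2 ⟨i, j, b, hb, rfl⟩)
  · simp [blockBits, elemBits]
  · funext i
    exact P.basis.sum_repr _

/-- The bounds on the parameters. -/
structure Params.Bounded (P : Params k) (N : ℕ) : Prop where
  n : P.n ≤ N
  digitBits : P.digitBits ≤ N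
  elemBits : P.elemBits ≤ N
  blockBits : P.blockBits ≤ N

/-- Bits are recovered coordinate by coordinate: a coordinate of the block is a sum of selected
constants in `ZMod P.p`, which `Eff.zmod_sum` evaluates. -/
lemma SumOf.sees (hP : P.Bounded N) (h : SumOf φ N S a ((N + 4) ^ e) x) (hd : a + e + 9 ≤ d) :
    Sees φ N S d P.blockObs x := by
  intro ψ hψ
  obtain ⟨i, j, b, hb, rfl⟩ := P.mem_blockObs.1 hψ
  obtain ⟨l, h1, h2, h3⟩ := h.map (H := ZMod P.p)
    (((P.basis.coord j).toAddMonoidHom).comp (Pi.evalAddMonoidHom (fun _ : Fin P.n => P.K) i))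
  have h4 := Eff.list (φ := φ) (N := N) (S := S) l (T := fun u => {u.1}) h1 h2 le_rfl
  have h5 := Eff.zmod_sum (φ := φ) (N := N) (S := S ∪ {p | ∃ u ∈ l, p ∈ ({u.1} : Set (Ω → Prop))})
    P.p_le hP.digitBits l (fun u hu => .inr ⟨u, hu, rfl⟩) h2
  simp only [← h3] at h5
  exact (h4.bind h5 (by omega) (by omega)).dec (mem_bitObs hb)

lemma SumOf.mulVec (A : P.Mat) {m : ℕ} (hx : SumOf φ N S a m x) :
    SumOf φ N S a m fun ω => A.mulVec (x ω) :=
  hx.map A.mulVecLin.toAddMonoidHom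

lemma SumOf.sub {m' : ℕ} (hx : SumOf φ N S a m x) (hy : SumOf φ N S a m' y) :
    SumOf φ N S a (m + m') fun ω => x ω - y ω := by
  exact (hx.add (hy.map (negAddMonoidHom : P.Block →+ P.Block))).congr fun ω =>
    (sub_eq_add_neg _ _).symm

/-! #### Words and blocks -/

/-- Decoding is additive in the bits; the reduction of the coordinates modulo `p` happens in the
cast of the powers of two. -/
lemma SumOf.decodeBlock {w : Ω → List Bool}
    (h : ∀ (i : ℕ) (c : Option Bool), Dec φ N S a fun ω => (w ω)[i]? = c) (r : ℕ) :
    SumOf φ N S a P.blockBits fun ω => P.decodeBlock ((w ω).drop r) := by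
  refine ((SumOf.block (z := fun i j ω => ((toNumber (((((w ω).drop r).drop (i * P.elemBits)).drop
    (j * P.digitBits)).take P.digitBits) : ℕ) : ZMod P.p)) fun i j =>
    SumOf.natCast (D := P.digitBits) (fun ω => (toNumber_lt _).trans_le
      (Nat.pow_le_pow_right (by omega) (List.length_take_le _ _)))
      fun b hb => ?_).mono (le_of_eq ?_)).congr fun ω => rfl
  · refine (h (r + i * P.elemBits + j * P.digitBits + b) (some true)).congr fun ω => ?_
    rw [testBit_toNumber, List.getElem?_take_of_lt hb]
    simp only [List.getElem?_drop, add_assoc]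
  · simp [blockBits, elemBits]

lemma Sees.letter_encodeBlock (h : Sees φ N S a P.blockObs x) (i : ℕ) (c : Option Bool) :
    Dec φ N S (a + 1) fun ω => (P.encodeBlock (x ω))[i]? = c := by
  refine Dec.letter_of_map (P.blockObs.map fun ψ ω => ψ (x ω)) ?_ (fun ω => ?_) i c
  · intro p hp
    obtain ⟨ψ, hψ, rfl⟩ := List.mem_map.1 hp
    exact h ψ hψ
  · rw [encodeBlock_eq, List.forall₂_map_left_iff, List.forall₂_map_right_iff, List.forall₂_same]
    simp

lemma Sees.letter_flatMap_encodeBlock {l : List (Ω → P.Block)}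
    (h : ∀ x ∈ l, Sees φ N S a P.blockObs x) (i : ℕ) (c : Option Bool) :
    Dec φ N S (a + 1) fun ω => ((l.map fun x => x ω).flatMap P.encodeBlock)[i]? = c := by
  refine Dec.letter_of_map (l.flatMap fun x => P.blockObs.map fun ψ ω => ψ (x ω)) ?_
    (fun ω => ?_) i c
  · intro p hp
    obtain ⟨x, hx, hp⟩ := List.mem_flatMap.1 hp
    obtain ⟨ψ, hψ, rfl⟩ := List.mem_map.1 hp
    exact h x hx ψ hψ
  · rw [List.flatMap_map]
    clear h
    induction l with
    | nil => simp
    | cons x l ih =>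
      rw [List.flatMap_cons, List.flatMap_cons]
      refine List.rel_append ?_ ih
      rw [encodeBlock_eq, List.forall₂_map_left_iff, List.forall₂_map_right_iff, List.forall₂_same]
      simp

lemma Dec.toNumber_eq {w : Ω → List Bool} (hw : ∀ ω, (w ω).length ≤ N)
    (h : ∀ (i : ℕ) (c : Option Bool), Dec φ N S a fun ω => (w ω)[i]? = c) (r v : ℕ) :
    Dec φ N S (a + 5) fun ω => toNumber ((w ω).drop r) = v := by
  by_cases hv : v < 2 ^ N
  · refine (Dec.forall_list (d := a + 5) (a := a + 1) (e := 1) (List.range N)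
      (p := fun b ω => (w ω)[r + b]? = some true ↔ v.testBit b = true) (fun b _ =>
      (h (r + b) (some true)).gate (fun x _ => x ↔ v.testBit b = true) (h (r + b) (some true))
        (by omega) (by omega)) (by simp) (by omega)).congr fun ω => ?_
    constructor
    · intro h1
      refine Nat.eq_of_testBit_eq fun b => Bool.eq_iff_iff.2 ?_
      rw [testBit_toNumber, List.getElem?_drop]
      by_cases hb : b < N
      · exact h1 b (List.mem_range.2 hb)
      · rw [List.getElem?_eq_none (by have := hw ω; omega), Nat.testBit_eq_false_of_lt
          (hv.trans_le (Nat.pow_le_pow_right (by omega) (not_lt.1 hb)))]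
        simp
    · rintro rfl b -
      rw [testBit_toNumber, List.getElem?_drop]
  · refine (Dec.const False).congr fun ω => ?_
    have h1 := toNumber_lt ((w ω).drop r)
    have h2 : 2 ^ ((w ω).drop r).length ≤ 2 ^ N :=
      Nat.pow_le_pow_right (by omega) (by rw [List.length_drop]; have := hw ω; omega)
    simp only [false_iff]
    omega

/-- The answers of the oracle that evaluates a permutation. -/
noncomputable def permAnswer (P : Params k) (f : Equiv.Perm P.K) (w : List Bool) : List Bool :=
  P.encodeElem (f (P.decodeElem w))

/-- Evaluation of the permutation at the entries of a block. -/
lemma Sees.perm {S : Set (Equiv.Perm P.K → Prop)} {x : Equiv.Perm P.K → P.Block}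
    (hP : P.Bounded N) (h : Sees (permAnswer P) N S a P.blockObs x) (hd : a + 4 ≤ d) :
    Sees (permAnswer P) N S d P.blockObs fun f => f ∘ x f := by
  have hl : P.blockObs.length ≤ (N + 4) ^ 1 := by
    rw [length_blockObs, pow_one]
    have := hP.blockBits
    omega
  have key : ∀ i ∈ List.finRange P.n, Eff (permAnswer P) N (S ∪ obs P.blockObs x) 2
      {p | p ∈ P.elemObs.map fun ψ f => ψ (f (x f i))} := by
    intro i _
    -- One oracle gate per entry. Query and answer are encodings of field elements, so their length
    -- does not depend on `f`, as an oracle gate requires.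
    refine Builds.mono (.oracle (P.elemObs.map fun ψ f => ψ (x f i))
      (P.elemObs.map fun ψ f => ψ (f (x f i))) (fun f => P.encodeElem (x f i)) ?_ ?_ ?_) ?_ le_rfl
    · intro p hp
      obtain ⟨ψ, hψ, rfl⟩ := List.mem_map.1 hp
      refine .inr ⟨fun v => ψ (v i), ?_, rfl⟩
      exact List.mem_flatMap.2 ⟨i, List.mem_finRange i, List.mem_map_of_mem hψ⟩
    · intro f
      rw [encodeElem_eq, List.forall₂_map_left_iff, List.forall₂_map_right_iff, List.forall₂_same]
      simp
    · intro f
      rw [permAnswer, decodeElem_encodeElem, encodeElem_eq, List.forall₂_map_left_iff,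
        List.forall₂_map_right_iff, List.forall₂_same]
      simp
    · rw [List.length_map, List.length_map, length_elemObs]
      have := hP.elemBits
      nlinarith
  refine Eff.sees (((h.eff hl le_rfl).bind (Eff.list (e := 1) (d := 3) _ key (by simp; have := hP.n; omega) le_rfl)
    (by omega) (by omega) : Eff (permAnswer P) N S d _).right ?_)
  rintro _ ⟨ψ, hψ, rfl⟩
  obtain ⟨i, -, hi⟩ := List.mem_flatMap.1 hψ
  obtain ⟨χ, hχ, rfl⟩ := List.mem_map.1 hi
  exact ⟨i, List.mem_finRange i, List.mem_map.2 ⟨χ, hχ, rfl⟩⟩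

end Eff

/-! ### Circuits for the left-or-right oracles -/

namespace Params

variable {k : ℕ} {P : Params k}

/-- The default stands in for session numbers not in use; it is inactive and has the past length
that its clock demands. -/
noncomputable instance : Inhabited P.Session := ⟨⟨0, 0, 0, 0, [], false⟩⟩

/-- The invariants of a session: the clock is at most `t`, and there are as many past blocks as the
clock says. -/
structure Session.Valid (x : P.Session) (t : ℕ) : Prop where
  clock : x.clock ≤ t
  past : x.past.length = x.clock

lemma Session.valid_default (t : ℕ) : (default : P.Session).Valid t := ⟨Nat.zero_le _, rfl⟩

lemma Session.Valid.mono {x : P.Session} {t t' : ℕ} (h : x.Valid t) (ht : t ≤ t') : x.Valid t' :=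
  ⟨h.clock.trans ht, h.past⟩

lemma Session.Valid.encrypt {x : P.Session} {t : ℕ} (h : x.Valid t) (sec : P.Secret)
    (f : Equiv.Perm P.K) (o : Kind) (p : P.Block) : (x.encrypt sec f o p).2.Valid (t + 1) := by
  have := h.clock
  have := h.past
  rcases o <;> exact ⟨by simpa [Session.encrypt], by simpa [Session.encrypt]⟩

variable (P) in
/-- The contents of a session with clock at most `t`. -/
def sessionObs (t : ℕ) : List (P.Session → Prop) :=
  (eqs (List.range (t + 1))).map (fun ψ x => ψ x.clock) ++
  P.blockObs.map (fun ψ x => ψ x.state) ++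
  P.blockObs.map (fun ψ x => ψ x.memory) ++
  P.blockObs.map (fun ψ x => ψ x.current) ++
  ((List.range t).flatMap fun j => P.blockObs.map fun ψ x => ψ (x.past.getD j 0)) ++
  [fun x => x.active = true]

lemma length_sessionObs (t : ℕ) :
    (P.sessionObs t).length = t + 1 + P.blockBits * 3 + t * P.blockBits + 1 := by
  simp [sessionObs, length_blockObs, List.length_flatMap]
  ring

/-- The parameters of the cryptosystem are bounded by `N`, and the switching function can be
computed up to time `t`. -/
structure Feasible (P : Params k) (N t : ℕ) : Prop extends P.Bounded N where
  ell : P.ell ≤ N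
  time : t + 1 ≤ N
  room : (t + 1) * P.blockBits ≤ N
  sigma : ∀ u ≤ t, ∃ T : Machine, T.size ≤ N ∧ ∃ s ≤ N,
    ∀ cs : List P.Block, cs.length = min (u + 1) P.window →
      toNumber (Machine.runWith (fun _ => false) (fun _ => [])
        (T.initial (cs.flatMap P.encodeBlock)) s).query = (P.sigma u cs : ℕ)

lemma Feasible.length_sessionObs_le {N t : ℕ} (h : P.Feasible N t) :
    (P.sessionObs t).length ≤ (N + 4) ^ 2 := by
  rw [length_sessionObs]
  have h1 := h.time
  have h2 := h.room
  have h3 := h.blockBits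
  nlinarith

end Params

section Eff

open Params

variable {Ω : Type} {φ : Ω → List Bool → List Bool} {N t : ℕ} {S : Set (Ω → Prop)} {a d : ℕ}
  {k : ℕ} {P : Params k} {x : Ω → P.Session}

variable (φ N S) in
/-- The contents of a session are computable. -/
structure SeesSession (a t : ℕ) (x : Ω → P.Session) : Prop where
  clock : ∀ u ≤ t, Dec φ N S a fun ω => (x ω).clock = u
  state : Sees φ N S a P.blockObs fun ω => (x ω).state
  memory : Sees φ N S a P.blockObs fun ω => (x ω).memory
  current : Sees φ N S a P.blockObs fun ω => (x ω).current
  past : ∀ j < t, Sees φ N S a P.blockObs fun ω => (x ω).past.getD j 0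
  active : Dec φ N S a fun ω => (x ω).active = true

lemma sees_sessionObs : Sees φ N S a (P.sessionObs t) x ↔ SeesSession φ N S a t x := by
  constructor
  · intro h
    refine ⟨fun u hu => h (fun x => x.clock = u) ?_, fun ψ hψ => h (fun x => ψ x.state) ?_,
      fun ψ hψ => h (fun x => ψ x.memory) ?_, fun ψ hψ => h (fun x => ψ x.current) ?_,
      fun j hj ψ hψ => h (fun x => ψ (x.past.getD j 0)) ?_, h (fun x => x.active = true) ?_⟩ <;>
      simp only [sessionObs, List.mem_append, List.mem_map, List.mem_flatMap, or_assoc]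
    · exact .inl ⟨_, mem_eqs (List.mem_range.2 (by omega)), rfl⟩
    · exact .inr (.inl ⟨ψ, hψ, rfl⟩)
    · exact .inr (.inr (.inl ⟨ψ, hψ, rfl⟩))
    · exact .inr (.inr (.inr (.inl ⟨ψ, hψ, rfl⟩)))
    · exact .inr (.inr (.inr (.inr (.inl ⟨j, List.mem_range.2 hj, ψ, hψ, rfl⟩))))
    · simp
  · intro h ψ hψ
    simp only [sessionObs, List.mem_append, List.mem_map, List.mem_flatMap, or_assoc, eqs,
      List.mem_range, List.mem_singleton] at hψ
    rcases hψ with ⟨_, ⟨u, hu, rfl⟩, rfl⟩ | ⟨ψ, hψ, rfl⟩ | ⟨ψ, hψ, rfl⟩ | ⟨ψ, hψ, rfl⟩ |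
      ⟨j, hj, ψ, hψ, rfl⟩ | rfl
    exacts [h.clock u (by omega), h.state ψ hψ, h.memory ψ hψ, h.current ψ hψ, h.past j hj ψ hψ,
      h.active]

/-- The mode of a session is computable. -/
lemma SeesSession.mode (hP : P.Feasible N t) (h : SeesSession φ N S a t x)
    (hx : ∀ ω, (x ω).Valid t) (j : Fin P.ell) :
    Dec φ N S (a + 22) fun ω => (x ω).mode = j := by
  let y : ℕ → Ω → P.Block := fun r ω => ((x ω).current :: (x ω).past).getD r 0
  have hy : ∀ r ≤ t, Sees φ N S a P.blockObs (y r) := by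
    intro r hr
    rcases r with _ | r
    · exact h.current
    · exact h.past r (by omega)
  let l : ℕ → List (Ω → P.Block) := fun u => ((List.range (u + 1)).map y).take P.window
  have hl : ∀ u, (l u).length = min (u + 1) P.window := fun u => by simp [l, min_comm]
  -- Since the past is as long as the clock says, the list given to the switching function has a
  -- fixed length once the clock is fixed.
  have hcs : ∀ ω, ((x ω).current :: (x ω).past).take P.window
      = (l (x ω).clock).map fun z => z ω := by
    intro ω
    simp only [l, List.map_take, List.map_map]
    congr 1
    refine List.ext_getElem (by simp [(hx ω).past]) fun i h1 h2 => ?_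
    simp [y, List.getElem?_eq_getElem h1]
  -- For each possible clock `u`, the machine for `sigma` at time `u` is simulated; the true clock
  -- selects among the results.
  have hS : ∀ u ∈ List.range (t + 1), Dec φ N S (a + 19) fun ω =>
      P.sigma u ((l u).map fun z => z ω) = j := by
    intro u hu
    rw [List.mem_range] at hu
    obtain ⟨T, hT, s, hs, h1⟩ := hP.sigma u (by omega)
    have h2 : ∀ z ∈ l u, Sees φ N S a P.blockObs z := by
      intro z hz
      obtain ⟨r, hr, rfl⟩ := List.mem_map.1 (List.mem_of_mem_take hz)
      exact hy r (by rw [List.mem_range] at hr; omega)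
    have h3 : ∀ ω, (((l u).map fun z => z ω).flatMap P.encodeBlock).length ≤ N := by
      intro ω
      simp only [List.length_flatMap, length_encodeBlock, List.map_const', List.sum_replicate,
        List.length_map, hl, smul_eq_mul]
      exact (Nat.mul_le_mul_right _ ((min_le_left _ _).trans (by omega))).trans hP.room
    have h4 := Eff.runWith_query hT h3 (Sees.letter_flatMap_encodeBlock h2) s hs
      (show max (a + 1 + 4) 14 ≤ a + 14 by omega)
    refine (Dec.toNumber_eq (fun ω => (Machine.within_runWith _ _ _ s).query.trans hs) h4 0
      (j : ℕ)).congr fun ω => ?_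
    rw [List.drop_zero, h1 _ (by simp [hl]), Fin.ext_iff]
  refine (Dec.cases (fun ω => (x ω).clock) (List.range (t + 1)) (e := 1)
    (p := fun u ω => P.sigma u ((l u).map fun z => z ω) = j)
    (fun u hu => h.clock u (by rw [List.mem_range] at hu; omega)) hS
    (by have := hP.time; simp; omega)
    (fun ω hω => absurd (List.mem_range.2 (by have := (hx ω).clock; omega)) hω)
    (by omega) (by omega)).congr fun ω => ?_
  rw [Session.mode, hcs]

/-- The result of the encryption of a block in a session is computable. -/
lemma SeesSession.encrypt {S : Set (Equiv.Perm P.K → Prop)} {x : Equiv.Perm P.K → P.Session}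
    {p : Equiv.Perm P.K → P.Block} (hP : P.Feasible N t) (h : SeesSession (permAnswer P) N S a t x)
    (hx : ∀ f, (x f).Valid t) (hp : Sees (permAnswer P) N S a P.blockObs p)
    (sec : P.Secret) (o : Kind) :
    Sees (permAnswer P) N S (a + 25) P.blockObs (fun f => ((x f).encrypt sec f o (p f)).1) ∧
      Sees (permAnswer P) N S (a + 25) (P.sessionObs t)
        (fun f => ((x f).encrypt sec f o (p f)).2) := by
  have hs := (h.state.le (show a ≤ a + 4 by omega)).sumOf
  have hm := (h.memory.le (show a ≤ a + 4 by omega)).sumOf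
  have hc := (h.current.le (show a ≤ a + 4 by omega)).sumOf
  have hfs := (h.state.perm hP.toBounded le_rfl).sumOf
  have hfp := (hp.perm hP.toBounded le_rfl).sumOf
  have hbits := hP.blockBits
  -- The longest sum is that of `decUpdate`: three blocks for memory, state and permuted state,
  -- three for the ciphertext, two for the subtracted keystream.
  have hlen : 8 * P.blockBits ≤ (N + 4) ^ 2 := by nlinarith
  have hk := fun j => (hs.mulVec (sec.L j : P.Mat)).add (hfs.mulVec (P.B j : P.Mat))
  have hcipher := fun j => (hk j).add (hfp.mulVec (sec.F j : P.Mat))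
  -- For a fixed mode all matrices are constants; the actual mode selects among the results.
  have key : ∀ z : Fin P.ell → Equiv.Perm P.K → P.Block,
      (∀ j, SumOf (permAnswer P) N S (a + 4) (8 * P.blockBits) (z j)) →
      Sees (permAnswer P) N S (a + 25) P.blockObs fun f => z (x f).mode f := by
    intro z hz
    exact Sees.cases (fun f => (x f).mode) (List.finRange P.ell) (e := 1)
      (fun j _ => h.mode hP hx j)
      (fun j _ => ((hz j).mono hlen).sees hP.toBounded (show a + 4 + 2 + 9 ≤ a + 22 by omega))
      (by have := hP.ell; simp; omega) (fun f => List.mem_finRange _) (by omega) (by omega)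
  have h1 : Sees (permAnswer P) N S (a + 25) P.blockObs
      fun f => sec.cipher f (x f).mode (x f).state (p f) :=
    key (fun j f => sec.cipher f j (x f).state (p f)) fun j => (hcipher j).mono (by omega)
  have h2 : Sees (permAnswer P) N S (a + 25) P.blockObs
      fun f => sec.encUpdate f (x f).mode (x f).memory (x f).state (p f) :=
    key (fun j f => sec.encUpdate f j (x f).memory (x f).state (p f)) fun j =>
      ((((hm.mulVec (sec.W : P.Mat)).add (hs.mulVec (sec.D j))).add (hfs.mulVec (sec.A j))).add
        (hfp.mulVec (P.E j : P.Mat))).mono (by omega)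
  have h3 : Sees (permAnswer P) N S (a + 25) P.blockObs
      fun f => sec.decUpdate f (x f).mode (x f).memory (x f).state
        (sec.cipher f (x f).mode (x f).state (p f)) :=
    key (fun j f => sec.decUpdate f j (x f).memory (x f).state
        (sec.cipher f j (x f).state (p f))) fun j =>
      ((((hm.mulVec (sec.W : P.Mat)).add (hs.mulVec (sec.D j))).add (hfs.mulVec (sec.A j))).add
        (((hcipher j).sub (hk j)).mulVec (sec.R j))).mono (by omega)
  have h4 : Sees (permAnswer P) N S (a + 25) P.blockObs
      fun f => P.M.mulVec (x f).memory + (x f).current :=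
    (((hm.mulVec P.M).add hc).mono (show _ ≤ (N + 4) ^ 2 by omega)).sees hP.toBounded (by omega)
  have h5 : ∀ s : Equiv.Perm P.K → P.Block, Sees (permAnswer P) N S (a + 25) P.blockObs s →
      SeesSession (permAnswer P) N S (a + 25) t fun f =>
        { clock := (x f).clock + 1
          state := s f
          memory := P.M.mulVec (x f).memory + (x f).current
          current := sec.cipher f (x f).mode (x f).state (p f)
          past := (x f).current :: (x f).past
          active := true } := by
    intro s hs
    refine ⟨fun u hu => ?_, hs, h4, h1, fun j hj => ?_, Dec.const (true = true)⟩
    · rcases u with _ | u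
      · exact (Dec.const False).congr fun f => by simp
      · exact ((h.clock u (by omega)).le (by omega)).congr fun f => by simp
    · rcases j with _ | j
      · exact h.current.le (by omega)
      · exact (h.past j (by omega)).le (by omega)
  rcases o with _ | _
  · exact ⟨h.current.le (by omega), sees_sessionObs.2 (h5 _ h2)⟩
  · exact ⟨h1, sees_sessionObs.2 (h5 _ h3)⟩

end Eff

/-! ### The oracles as deterministic functions of a random block -/

namespace Params

variable {k : ℕ} {P : Params k}

variable (P) in
/-- The states of the two oracles. -/
abbrev State : Type := Kind → List P.Session

open Classical in
/-- The oracle's reaction to a request that concerns the session number `i`. -/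
noncomputable def touch (o : Kind) (i : ℕ) (g : P.Session → List Bool × P.Session)
    (st : P.State) : List Bool × P.State :=
  if i < (st o).length ∧ ((st o).getD i default).active = true then
    ((g ((st o).getD i default)).1,
      Function.update st o ((st o).set i (g ((st o).getD i default)).2))
  else ([], st)

/-- The oracle's reaction to a request, if the initial state of a new session is `s`. -/
noncomputable def respond (sec : P.Secret) (f : Equiv.Perm P.K) (b : Bool) (s : P.Block)
    (st : P.State) : Option P.Request → List Bool × P.State
  | some (.newSession o m c) =>
    ((match o with
      | .E => []
      | .SE => P.encodeBlock c) ++ Nat.bits (st o).length,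
    Function.update st o (st o ++
      [{ clock := 1, state := s, memory := m, current := c, past := [c], active := true }]))
  | some (.encrypt o p₀ p₁ i) =>
    touch o i (fun x => (P.encodeBlock (x.encrypt sec f o (bif b then p₁ else p₀)).1,
      (x.encrypt sec f o (bif b then p₁ else p₀)).2)) st
  | some (.close o i) =>
    touch o i (fun x => ((match o with
      | .E => P.encodeBlock x.current
      | .SE => []), { x with active := false })) st
  | none => ([], st)

lemma touch_eq (o : Kind) (i : ℕ) (g : P.Session → List Bool × P.Session) (st : P.State) :
    touch o i g st = match (st o)[i]? with
      | some x => if x.active then ((g x).1, Function.update st o ((st o).set i (g x).2))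
        else ([], st)
      | none => ([], st) := by
  rw [touch]
  by_cases h : i < (st o).length
  · rw [List.getElem?_eq_getElem h]
    simp [h, List.getD_eq_getElem?_getD]
  · rw [List.getElem?_eq_none (by omega)]
    simp [h]

/-- A random block is drawn for every request, even if it is not used. Its distribution then depends
neither on the request nor on `f`, so that it can later be fixed. -/
lemma oracle_eq_map_respond (sec : P.Secret) (f : Equiv.Perm P.K) (b : Bool) (st : P.State)
    (w : List Bool) :
    P.oracle sec f b st w =
      letI : Fintype P.Block := Fintype.ofFinite _
      (PMF.uniformOfFintype P.Block).map fun s => respond sec f b s st (P.parse w) := by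
  rw [oracle]
  rcases P.parse w with _ | ⟨o, m, c⟩ | ⟨o, p₀, p₁, i⟩ | ⟨o, i⟩
  · simp only [respond]
    exact (PMF.map_const _ _).symm
  · rfl
  · simp only [respond, touch_eq]
    exact (PMF.map_const _ _).symm
  · simp only [respond, touch_eq]
    exact (PMF.map_const _ _).symm

/-- There are at most `t` sessions, with valid histories. -/
def StateValid (st : P.State) (t : ℕ) : Prop :=
  ∀ o, (st o).length ≤ t ∧ ∀ x ∈ st o, x.Valid (t + 1)

lemma StateValid.mono {st : P.State} {t t' : ℕ} (h : StateValid st t) (ht : t ≤ t') :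
    StateValid st t' := fun o =>
  ⟨(h o).1.trans ht, fun x hx => ((h o).2 x hx).mono (by omega)⟩

lemma StateValid.getD {st : P.State} {t : ℕ} (h : StateValid st t) (o : Kind) (i : ℕ) :
    ((st o).getD i default).Valid (t + 1) := by
  by_cases hi : i < (st o).length
  · rw [List.getD_eq_getElem _ _ hi]
    exact (h o).2 _ (List.getElem_mem hi)
  · rw [List.getD_eq_default _ _ (by omega)]
    exact Session.valid_default _

lemma StateValid.update {st : P.State} {t : ℕ} (h : StateValid st t) (o : Kind)
    {l : List P.Session} (hl : l.length ≤ t) (hx : ∀ x ∈ l, x.Valid (t + 1)) :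
    StateValid (Function.update st o l) t := by
  intro o'
  by_cases e : o' = o
  · subst e
    simpa using ⟨hl, hx⟩
  · rw [Function.update_of_ne e]
    exact h o'

lemma StateValid.touch {st : P.State} {t : ℕ} (h : StateValid st t) (o : Kind) (i : ℕ)
    {g : P.Session → List Bool × P.Session}
    (hg : ∀ x : P.Session, x.Valid (t + 1) → (g x).2.Valid (t + 2)) :
    StateValid (touch o i g st).2 (t + 1) := by
  rw [Params.touch]
  split_ifs
  · refine (h.mono (by omega)).update o (by rw [List.length_set]; have := (h o).1; omega)
      fun x hx => ?_
    rcases List.mem_or_eq_of_mem_set hx with hx | rfl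
    · exact ((h o).2 x hx).mono (by omega)
    · exact hg _ (h.getD o i)
  · exact h.mono (by omega)

lemma StateValid.respond {st : P.State} {t : ℕ} (h : StateValid st t) (sec : P.Secret)
    (f : Equiv.Perm P.K) (b : Bool) (s : P.Block) (r : Option P.Request) :
    StateValid (respond sec f b s st r).2 (t + 1) := by
  rcases r with _ | ⟨o, m, c⟩ | ⟨o, p₀, p₁, i⟩ | ⟨o, i⟩
  · exact h.mono (by omega)
  · refine (h.mono (by omega)).update o (by have := (h o).1; simpa) fun x hx => ?_
    rcases List.mem_append.1 hx with hx | hx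
    · exact ((h o).2 x hx).mono (by omega)
    · rw [List.mem_singleton.1 hx]
      exact ⟨by simp, rfl⟩
  · exact h.touch o i fun x hx => hx.encrypt sec f o _
  · exact h.touch o i fun x hx => ⟨hx.clock.trans (by omega), hx.past⟩

lemma length_bits_le (n : ℕ) : n.bits.length ≤ n := by
  rw [Nat.size_eq_bits_len]
  exact Nat.size_le.2 n.lt_two_pow_self

lemma length_respond_le {st : P.State} {t : ℕ} (h : StateValid st t) (sec : P.Secret)
    (f : Equiv.Perm P.K) (b : Bool) (s : P.Block) (r : Option P.Request) :
    (respond sec f b s st r).1.length ≤ P.blockBits + t := by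
  have key : ∀ o i (g : P.Session → List Bool × P.Session),
      (∀ x, (g x).1.length ≤ P.blockBits) → (touch o i g st).1.length ≤ P.blockBits + t := by
    intro o i g hg
    rw [Params.touch]
    split_ifs
    · exact (hg _).trans (by omega)
    · simp
  rcases r with _ | ⟨o, m, c⟩ | ⟨o, p₀, p₁, i⟩ | ⟨o, i⟩
  · simp [respond]
  · have h1 := (h o).1
    have h2 := length_bits_le (st o).length
    rcases o <;> simp only [respond, List.length_append, length_encodeBlock, List.length_nil] <;>
      omega
  · exact key o i _ fun x => (length_encodeBlock _ _).le
  · refine key o i _ fun x => ?_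
    rcases o
    · exact (length_encodeBlock _ _).le
    · simp

variable (P) in
/-- The request in a word whose first letters are given. -/
noncomputable def parseLetters (w : List Bool) : Option Bool → Option Bool → Option Bool →
    Option P.Request
  | some o, some false, _ => some (.newSession (bif o then .SE else .E)
      (P.decodeBlock (w.drop 2)) (P.decodeBlock (w.drop (2 + P.blockBits))))
  | some o, some true, some false => some (.encrypt (bif o then .SE else .E)
      (P.decodeBlock (w.drop 3)) (P.decodeBlock (w.drop (3 + P.blockBits)))
      (toNumber (w.drop (3 + 2 * P.blockBits))))
  | some o, some true, some true => some (.close (bif o then .SE else .E) (toNumber (w.drop 3)))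
  | _, _, _ => none

/-- Three letters determine the kind of a request, so parsing becomes a case distinction over
letters. -/
lemma parse_eq (w : List Bool) : P.parse w = P.parseLetters w w[0]? w[1]? w[2]? := by
  rcases w with _ | ⟨o, _ | ⟨_ | _, _ | ⟨_ | _, w⟩⟩⟩ <;>
    simp [parse, parseLetters, add_comm _ P.blockBits, add_comm _ (2 * P.blockBits)]

variable (P) in
/-- The contents of at most `t` sessions of each oracle. -/
def stateObs (t : ℕ) : List (P.State → Prop) :=
  [Kind.E, Kind.SE].flatMap fun o =>
    (eqs (List.range (t + 1))).map (fun ψ st => ψ (st o).length) ++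
    (List.range t).flatMap fun i =>
      (P.sessionObs t).map fun ψ st => ψ ((st o).getD i default)

lemma Feasible.length_stateObs_le {N t : ℕ} (h : P.Feasible N t) :
    (P.stateObs t).length ≤ (N + 4) ^ 4 := by
  have h1 := h.length_sessionObs_le
  have h2 := h.time
  have h3 : (P.stateObs t).length = (t + 1 + t * (P.sessionObs t).length) * 2 := by
    simp [stateObs, List.length_flatMap]
    ring
  rw [h3]
  have h4 : t * (P.sessionObs t).length ≤ N * (N + 4) ^ 2 := Nat.mul_le_mul (by omega) h1
  have h5 : (N + N * (N + 4) ^ 2) * 2 ≤ (N + 4) ^ 4 := by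
    ring_nf
    nlinarith [Nat.zero_le (N ^ 4), Nat.zero_le (N ^ 3), Nat.zero_le (N ^ 2)]
  omega

end Params

/-! ### Circuits for the answers and the states of the oracles -/

section Eff

open Params

variable {Ω : Type} {φ : Ω → List Bool → List Bool} {N t : ℕ} {S : Set (Ω → Prop)} {a d : ℕ}
  {k : ℕ} {P : Params k} {st : Ω → P.State}

variable (φ N S) in
/-- The contents of the sessions are computable. -/
structure SeesState (a t : ℕ) (st : Ω → P.State) : Prop where
  length : ∀ o, ∀ n ≤ t, Dec φ N S a fun ω => (st ω o).length = n
  session : ∀ o, ∀ i < t, Sees φ N S a (P.sessionObs t) fun ω => (st ω o).getD i default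

lemma sees_stateObs : Sees φ N S a (P.stateObs t) st ↔ SeesState φ N S a t st := by
  have hk : ∀ o, o ∈ [Kind.E, Kind.SE] := fun o => by cases o <;> simp
  constructor
  · intro h
    refine ⟨fun o n hn => h (fun st => (st o).length = n) ?_,
      fun o i hi ψ hψ => h (fun st => ψ ((st o).getD i default)) ?_⟩
    · exact List.mem_flatMap.2 ⟨o, hk o, List.mem_append_left _
        (List.mem_map.2 ⟨_, mem_eqs (List.mem_range.2 (by omega)), rfl⟩)⟩
    · exact List.mem_flatMap.2 ⟨o, hk o, List.mem_append_right _
        (List.mem_flatMap.2 ⟨i, List.mem_range.2 hi, List.mem_map.2 ⟨ψ, hψ, rfl⟩⟩)⟩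
  · intro h ψ hψ
    obtain ⟨o, -, hψ⟩ := List.mem_flatMap.1 hψ
    simp only [List.mem_append, List.mem_map, List.mem_flatMap, eqs, List.mem_range] at hψ
    rcases hψ with ⟨_, ⟨n, hn, rfl⟩, rfl⟩ | ⟨i, hi, χ, hχ, rfl⟩
    exacts [h.length o n (by omega), h.session o i hi χ hχ]

lemma SeesState.le (h : SeesState φ N S a t st) (hd : a ≤ d) : SeesState φ N S d t st :=
  ⟨fun o n hn => (h.length o n hn).le hd, fun o i hi => (h.session o i hi).le hd⟩

variable (φ N S) in
/-- An answer and the contents of the sessions are computable. -/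
structure SeesResponse (a t : ℕ) (y : Ω → List Bool × P.State) : Prop where
  answer : ∀ (i : ℕ) (c : Option Bool), Dec φ N S a fun ω => (y ω).1[i]? = c
  state : SeesState φ N S a t fun ω => (y ω).2

lemma SeesResponse.le {y : Ω → List Bool × P.State} (h : SeesResponse φ N S a t y) (hd : a ≤ d) :
    SeesResponse φ N S d t y :=
  ⟨fun i c => (h.answer i c).le hd, h.state.le hd⟩

/-- Case distinction over the session number: session `v` changes only if it is the one addressed,
exists and is active. -/
lemma SeesState.touch (hst : SeesState φ N S a t st) (ht : t + 1 ≤ N)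
    (hlen : ∀ ω o, (st ω o).length ≤ t) {i : Ω → ℕ} (hi : ∀ v, Dec φ N S a fun ω => i ω = v)
    (o : Kind) {g : Ω → P.Session → List Bool × P.Session}
    (hg₁ : ∀ v < t, ∀ (r : ℕ) (c : Option Bool),
      Dec φ N S a fun ω => (g ω ((st ω o).getD v default)).1[r]? = c)
    (hg₂ : ∀ v < t, Sees φ N S a (P.sessionObs t) fun ω => (g ω ((st ω o).getD v default)).2) :
    SeesResponse φ N S (a + 10) t fun ω => touch o (i ω) (g ω) (st ω) := by
  let good : ℕ → Ω → Prop := fun v ω =>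
    v < (st ω o).length ∧ ((st ω o).getD v default).active = true
  have hgood : ∀ v < t, Dec φ N S (a + 4) (good v) := fun v hv =>
    Eff.and (a := a + 3) (b := a) (Dec.cases (fun ω => (st ω o).length) (List.range (t + 1))
      (e := 1) (p := fun n _ => v < n)
      (fun n hn => hst.length o n (by rw [List.mem_range] at hn; omega))
      (fun n _ => Dec.const (d := a) _) (by simp; omega)
      (fun ω hω => absurd (List.mem_range.2 (by have := hlen ω o; omega)) hω)
      (by omega) (by omega)) (sees_sessionObs.1 (hst.session o v hv)).active (by omega) (by omega)
  -- Numbers from `t` on belong to no session and violate `good`, so it suffices to compare `i` with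
  -- the numbers below `t`.
  have hcases : ∀ p : ℕ → Ω → Prop, (∀ v < t, Dec φ N S a (p v)) →
      Dec φ N S (a + 8) fun ω => good (i ω) ω ∧ p (i ω) ω := fun p hp =>
    Dec.cases i (List.range t) (e := 1) (p := fun v ω => good v ω ∧ p v ω) (fun v _ => hi v)
      (fun v hv => (hgood v (List.mem_range.1 hv)).and (d := a + 5) (hp v (List.mem_range.1 hv))
        (by omega) (by omega)) (by simp; omega)
      (fun ω hω h => hω (List.mem_range.2 (h.1.1.trans_le (hlen ω o)))) (by omega) (by omega)
  refine ⟨fun r c => ?_, ⟨fun o' n hn => ?_, fun o' v hv => ?_⟩⟩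
  · refine ((hcases (fun v ω => (g ω ((st ω o).getD v default)).1[r]? = c) fun v hv =>
      hg₁ v hv r c).gate (fun x y => x ∨ (¬ y ∧ (none = c)))
      (hcases (fun _ _ => True) fun _ _ => Dec.const _) (d := a + 10)
      (by omega) (by omega)).congr fun ω => ?_
    by_cases h : good (i ω) ω
    · rw [Params.touch, if_pos h]
      simp [h]
    · rw [Params.touch, if_neg h]
      simp [h]
  · refine ((hst.length o' n hn).le (by omega)).congr fun ω => ?_
    rw [Params.touch]
    split_ifs
    · by_cases e : o' = o
      · subst e
        simp
      · simp only [Function.update_of_ne e]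
    · rfl
  · by_cases e : o' = o
    · subst e
      refine (Sees.ite (d := a + 10) ((hgood v hv).and (d := a + 5) (hi v) (by omega) (by omega))
        (hg₂ v hv) (hst.session o' v hv) (by omega) (by omega) (by omega)).congr fun ω => ?_
      rw [Params.touch]
      by_cases h : good (i ω) ω
      · rw [if_pos h]
        simp only [Function.update_self]
        by_cases e : i ω = v
        · subst e
          rw [if_pos ⟨h, rfl⟩]
          simp only [List.getD_eq_getElem?_getD, List.getElem?_set_self h.1, Option.getD_some]
        · rw [if_neg fun h => e h.2]
          simp only [List.getD_eq_getElem?_getD, List.getElem?_set_ne e]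
      · rw [if_neg h, if_neg]
        rintro ⟨h1, rfl⟩
        exact h h1
    · refine ((hst.session o' v hv).le (by omega)).congr fun ω => ?_
      rw [Params.touch]
      split_ifs
      · simp only [Function.update_of_ne e]
      · rfl

lemma SeesState.newSession (hP : P.Feasible N t) (hst : SeesState φ N S a t st)
    (hlen : ∀ ω o, (st ω o).length ≤ t) (sec : P.Secret) (f : Ω → Equiv.Perm P.K)
    (b : Bool) (s : P.Block) (o : Kind) {m c : Ω → P.Block} (hm : Sees φ N S a P.blockObs m)
    (hc : Sees φ N S a P.blockObs c) :
    SeesResponse φ N S (a + 10) t fun ω =>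
      respond sec (f ω) b s (st ω) (some (.newSession o (m ω) (c ω))) := by
  have htN := hP.time
  have hnew : SeesSession φ N S a t fun ω =>
      { clock := 1, state := s, memory := m ω, current := c ω, past := [c ω], active := true } := by
    refine ⟨fun u hu => Dec.const (1 = u), Sees.const _, hm, hc, fun j hj => ?_,
      Dec.const (true = true)⟩
    rcases j with _ | j
    · exact hc
    · exact Sees.const (0 : P.Block)
  refine ⟨fun r l => ?_, ⟨fun o' n hn => ?_, fun o' v hv => ?_⟩⟩
  · refine (Dec.cases (a := a + 1) (d := a + 10) (fun ω => (st ω o).length) (List.range (t + 1))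
      (e := 1)
      (p := fun n ω => ((match o with
        | .E => []
        | .SE => P.encodeBlock (c ω)) ++ Nat.bits n)[r]? = l)
      (fun n hn => hst.length o n (by rw [List.mem_range] at hn; omega)) (fun n _ => ?_)
      (by simp; omega)
      (fun ω hω => absurd (List.mem_range.2 (by have := hlen ω o; omega)) hω)
      (by omega) (by omega))
    rcases o
    · exact Dec.const (([] ++ Nat.bits n)[r]? = l)
    · simp only [List.getElem?_append, length_encodeBlock]
      by_cases hr : r < P.blockBits
      · simpa only [hr, if_true] using hc.letter_encodeBlock r l
      · simpa only [hr, if_false] using Dec.const _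
  · by_cases e : o' = o
    · subst e
      rcases n with _ | n
      · exact (Dec.const False).congr fun ω => by simp [respond]
      · exact ((hst.length o' n (by omega)).le (by omega)).congr fun ω => by simp [respond]
    · exact ((hst.length o' n hn).le (by omega)).congr fun ω => by
        simp only [respond, Function.update_of_ne e]
  · by_cases e : o' = o
    · subst e
      -- The new session gets the number that equals the old length of the list.
      refine (Sees.ite (d := a + 10) (hst.length o' v hv.le) (sees_sessionObs.2 hnew)
        (hst.session o' v hv) (by omega) (by omega) (by omega)).congr fun ω => ?_
      simp only [respond, Function.update_self]
      rcases lt_trichotomy v (st ω o').length with h | h | h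
      · rw [if_neg (by omega), List.getD_append _ _ _ _ h]
      · rw [if_pos h.symm, List.getD_append_right _ _ _ _ (by omega)]
        simp [h]
      · rw [if_neg (by omega), List.getD_eq_default _ _ (by omega),
          List.getD_eq_default _ _ (by simp; omega)]
    · exact ((hst.session o' v hv).le (by omega)).congr fun ω => by
        simp only [respond, Function.update_of_ne e]

lemma SeesState.encrypt {S : Set (Equiv.Perm P.K → Prop)} {st : Equiv.Perm P.K → P.State}
    (hP : P.Feasible N (t + 1)) (hst : SeesState (permAnswer P) N S a (t + 1) st)
    (hval : ∀ f, StateValid (st f) t) (sec : P.Secret) (b : Bool) (s : P.Block)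
    {i : Equiv.Perm P.K → ℕ} (hi : ∀ v, Dec (permAnswer P) N S (a + 36) fun f => i f = v)
    (o : Kind) {p₀ p₁ : Equiv.Perm P.K → P.Block}
    (h₀ : Sees (permAnswer P) N S (a + 10) P.blockObs p₀)
    (h₁ : Sees (permAnswer P) N S (a + 10) P.blockObs p₁) :
    SeesResponse (permAnswer P) N S (a + 46) (t + 1)
      fun f => respond sec f b s (st f) (some (.encrypt o (p₀ f) (p₁ f) (i f))) := by
  -- The exponent grows by 10 for the decoded blocks, 25 for the encryption, 1 for the letters of
  -- the answer and 10 for `touch`.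
  have h := fun v hv => (sees_sessionObs.1 ((hst.session o v hv).le
    (show a ≤ a + 10 by omega))).encrypt hP (fun f => (hval f).getD o v)
    (p := fun f => bif b then p₁ f else p₀ f) (by cases b <;> assumption) sec o
  exact (hst.le (show a ≤ a + 36 by omega)).touch hP.time
    (fun f o => (hval f o).1.trans (by omega)) hi o
    (g := fun f x => (P.encodeBlock (x.encrypt sec f o (bif b then p₁ f else p₀ f)).1,
      (x.encrypt sec f o (bif b then p₁ f else p₀ f)).2))
    (fun v hv => (h v hv).1.letter_encodeBlock) (fun v hv => (h v hv).2.le (by omega))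

lemma SeesState.close {S : Set (Equiv.Perm P.K → Prop)} {st : Equiv.Perm P.K → P.State}
    (hP : P.Feasible N (t + 1)) (hst : SeesState (permAnswer P) N S a (t + 1) st)
    (hval : ∀ f, StateValid (st f) t) (sec : P.Secret) (b : Bool) (s : P.Block)
    {i : Equiv.Perm P.K → ℕ} (hi : ∀ v, Dec (permAnswer P) N S (a + 36) fun f => i f = v)
    (o : Kind) :
    SeesResponse (permAnswer P) N S (a + 46) (t + 1)
      fun f => respond sec f b s (st f) (some (.close o (i f))) := by
  have h₁ := fun v hv => sees_sessionObs.1 (hst.session o v hv)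
  have h₂ : ∀ v < t + 1, Sees (permAnswer P) N S a (P.sessionObs (t + 1)) fun f =>
      { (st f o).getD v default with active := false } := fun v hv =>
    sees_sessionObs.2 ⟨(h₁ v hv).clock, (h₁ v hv).state, (h₁ v hv).memory, (h₁ v hv).current,
      (h₁ v hv).past, Dec.const (false = true)⟩
  have h₃ := fun (g : P.Session → List Bool) => (hst.le (show a ≤ a + 36 by omega)).touch hP.time
    (fun f o => (hval f o).1.trans (by omega)) hi o (g := fun _ x => (g x, { x with active := false }))
  rcases o
  · exact h₃ (fun x => P.encodeBlock x.current)
      (fun v hv r c => ((h₁ v hv).current.letter_encodeBlock r c).le (by omega))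
      (fun v hv => (h₂ v hv).le (by omega))
  · exact h₃ (fun _ => []) (fun v hv r c => Dec.const (([] : List Bool)[r]? = c))
      (fun v hv => (h₂ v hv).le (by omega))

/-- The reaction of the oracles to a query is computable. -/
lemma SeesState.respond {S : Set (Equiv.Perm P.K → Prop)} {st : Equiv.Perm P.K → P.State}
    (hP : P.Feasible N (t + 1)) (hst : SeesState (permAnswer P) N S a (t + 1) st)
    (hval : ∀ f, StateValid (st f) t) (sec : P.Secret) (b : Bool) (s : P.Block)
    {w : Equiv.Perm P.K → List Bool} (hlen : ∀ f, (w f).length ≤ N)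
    (hw : ∀ (i : ℕ) (c : Option Bool), Dec (permAnswer P) N S a fun f => (w f)[i]? = c) :
    SeesResponse (permAnswer P) N S (a + 55) (t + 1)
      fun f => respond sec f b s (st f) (P.parse (w f)) := by
  have htN := hP.time
  have hlen' : ∀ f o, (st f o).length ≤ t + 1 := fun f o => (hval f o).1.trans (by omega)
  have hblock : ∀ r, Sees (permAnswer P) N S (a + 10) P.blockObs
      fun f => P.decodeBlock ((w f).drop r) := fun r =>
    ((SumOf.decodeBlock hw r).mono (show _ ≤ (N + 4) ^ 1 by
      have := hP.blockBits; rw [pow_one]; omega)).sees hP.toBounded (by omega)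
  have hnum : ∀ r v, Dec (permAnswer P) N S (a + 36) fun f => toNumber ((w f).drop r) = v :=
    fun r v => (Dec.toNumber_eq hlen hw r v).le (by omega)
  have key : ∀ y₀ y₁ y₂, SeesResponse (permAnswer P) N S (a + 46) (t + 1)
      fun f => Params.respond sec f b s (st f) (P.parseLetters (w f) y₀ y₁ y₂) := by
    intro y₀ y₁ y₂
    have hnone : SeesResponse (permAnswer P) N S (a + 46) (t + 1)
        fun f => Params.respond sec f b s (st f) none :=
      ⟨fun i c => Dec.const (([] : List Bool)[i]? = c), hst.le (by omega)⟩
    rcases y₀ with _ | o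
    · exact hnone
    rcases y₁ with _ | _ | _
    · exact hnone
    · exact ((hst.le (show a ≤ a + 10 by omega)).newSession hP hlen' sec _ b s _
        (hblock _) (hblock _)).le (by omega)
    rcases y₂ with _ | _ | _
    · exact hnone
    · exact hst.encrypt hP hval sec b s (hnum _) _ (hblock _) (hblock _)
    · exact hst.close hP hval sec b s (hnum _) _
  have hcases : ∀ ψ : List Bool × P.State → Prop,
      (∀ y₀ y₁ y₂, Dec (permAnswer P) N S (a + 46)
        fun f => ψ (Params.respond sec f b s (st f) (P.parseLetters (w f) y₀ y₁ y₂))) →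
      Dec (permAnswer P) N S (a + 55)
        fun f => ψ (Params.respond sec f b s (st f) (P.parse (w f))) := by
    intro ψ hψ
    have hw' := fun i c (n : ℕ) => (hw i c).le (show a ≤ a + 46 + n by omega)
    refine (Dec.letter_cases (a := a + 52) (p := fun y₀ f => ψ (Params.respond sec f b s (st f)
      (P.parseLetters (w f) y₀ (w f)[1]? (w f)[2]?))) (fun y => hw' 0 y 6) fun y₀ => ?_).congr
      fun f => by rw [parse_eq]
    refine Dec.letter_cases (a := a + 49) (p := fun y₁ f => ψ (Params.respond sec f b s (st f)
      (P.parseLetters (w f) y₀ y₁ (w f)[2]?))) (fun y => hw' 1 y 3) fun y₁ => ?_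
    exact Dec.letter_cases (a := a + 46) (p := fun y₂ f => ψ (Params.respond sec f b s (st f)
      (P.parseLetters (w f) y₀ y₁ y₂))) (fun y => hw' 2 y 0) fun y₂ => hψ y₀ y₁ y₂
  exact ⟨fun i c => hcases (fun y => y.1[i]? = c) fun y₀ y₁ y₂ => (key y₀ y₁ y₂).answer i c,
    ⟨fun o n hn => hcases (fun y => (y.2 o).length = n)
      fun y₀ y₁ y₂ => (key y₀ y₁ y₂).state.length o n hn,
    fun o i hi ψ hψ => hcases (fun y => ψ ((y.2 o).getD i default))
      fun y₀ y₁ y₂ => (key y₀ y₁ y₂).state.session o i hi ψ hψ⟩⟩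

end Eff

/-! ### The interaction of an adversary with the oracles, for fixed outcomes of all coins -/

/-- The instruction asks the oracle. -/
def Instr.IsAsk {r N : ℕ} : Instr r N → Prop
  | .ask _ => True
  | _ => False

section Simulation

open Params

variable {k : ℕ} {P : Params k} {T : Machine}

open Classical in
/-- One step of the interaction, given the outcome of the coin and the initial state for a new
session. -/
noncomputable def simStep (sec : P.Secret) (f : Equiv.Perm P.K) (b : Bool) (r : Bool × P.Block)
    (x : T.Cfg × P.State) : T.Cfg × P.State :=
  (Machine.stepWith r.1 (respond sec f b r.2 x.2 (P.parse x.1.query)).1 x.1,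
    if (T.instr x.1.state).IsAsk then (respond sec f b r.2 x.2 (P.parse x.1.query)).2 else x.2)

noncomputable def simRun (sec : P.Secret) (f : Equiv.Perm P.K) (b : Bool)
    (rs : List (Bool × P.Block)) (x : T.Cfg × P.State) : T.Cfg × P.State :=
  rs.foldl (fun x r => simStep sec f b r x) x

open Classical in
-- Every step draws a coin and a block; draws that are not used integrate out. A step is thus a mean
-- of deterministic steps with weights that do not involve `f`.
lemma step_oracle (sec : P.Secret) (f : Equiv.Perm P.K) (b : Bool) (x : T.Cfg × P.State) :
    letI : Fintype P.Block := Fintype.ofFinite _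
    Machine.step (P.oracle sec f b) x = (PMF.uniformOfFintype Bool).bind fun a =>
      (PMF.uniformOfFintype P.Block).bind fun s => PMF.pure (simStep sec f b (a, s) x) := by
  let _ : Fintype P.Block := Fintype.ofFinite _
  have hn : ∀ (I : Instr T.tapes T.states) (_ : ¬ I.IsAsk) (s : P.Block),
      (if I.IsAsk then (respond sec f b s x.2 (P.parse x.1.query)).2 else x.2) = x.2 :=
    fun I hI s => if_neg hI
  rw [Machine.step]
  simp only [simStep, Machine.stepWith]
  rcases T.instr x.1.state with ⟨i, next⟩ | ⟨a, next⟩ | next | next | next | a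
  · simp only [hn (.work i next) id, PMF.bind_const]
  · simp only [hn (.write a next) id, PMF.bind_const]
  · simp only [hn (.read next) id, PMF.bind_const]
  · simp only [if_pos (show (Instr.ask next : Instr T.tapes T.states).IsAsk from trivial),
      PMF.bind_const]
    rw [oracle_eq_map_respond, PMF.map_comp]
    rfl
  · simp only [hn (.toss next) id, PMF.bind_const]
    rfl
  · simp only [hn (.halt a) id, PMF.bind_const]

/-- The invariants of the interaction after `u` steps. -/
structure SimValid (x : T.Cfg × P.State) (u : ℕ) : Prop where
  within : x.1.Within u
  answer : x.1.answer.length ≤ P.blockBits + u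
  state : StateValid x.2 u

lemma SimValid.mono {x : T.Cfg × P.State} {u v : ℕ} (h : SimValid x u) (huv : u ≤ v) :
    SimValid x v :=
  ⟨⟨fun i j hj => h.within.work i j (by omega), h.within.query.trans huv⟩,
    h.answer.trans (by omega), h.state.mono huv⟩

lemma simValid_initial : SimValid (T.initial [], (fun _ => [] : P.State)) 0 :=
  ⟨Machine.within_initial _, by simp [Machine.initial], fun o => ⟨le_rfl, by simp⟩⟩

lemma SimValid.step {x : T.Cfg × P.State} {u : ℕ} (h : SimValid x u) (sec : P.Secret)
    (f : Equiv.Perm P.K) (b : Bool) (r : Bool × P.Block) :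
    SimValid (simStep sec f b r x) (u + 1) := by
  refine ⟨h.within.step _ _, ?_, ?_⟩
  · refine (Machine.length_answer_stepWith h.answer _ (length_respond_le h.state _ _ _ _ _)).trans ?_
    omega
  · simp only [simStep]
    split_ifs
    · exact h.state.respond sec f b _ _
    · exact h.state.mono (by omega)

lemma simValid_simRun (sec : P.Secret) (f : Equiv.Perm P.K) (b : Bool)
    (rs : List (Bool × P.Block)) :
    SimValid (simRun sec f b rs (T.initial [], fun _ => [])) rs.length := by
  induction rs using List.reverseRecOn with
  | nil => exact simValid_initial
  | append_singleton rs r ih =>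
    rw [simRun, List.foldl_append, List.length_append]
    exact ih.step sec f b r

variable {N t : ℕ}

lemma EffCfg.le {Ω : Type} {φ : Ω → List Bool → List Bool} {S : Set (Ω → Prop)} {a d : ℕ}
    {c : Ω → T.Cfg} (h : EffCfg φ N S a c) (hd : a ≤ d) : EffCfg φ N S d c :=
  ⟨fun q => (h.state q).le hd, fun i j b => (h.work i j b).le hd, fun i b => (h.query i b).le hd,
    fun i b => (h.answer i b).le hd⟩

variable (T P) in
/-- The contents of the configuration and of the sessions. -/
def simObs (N t : ℕ) (x : Equiv.Perm P.K → T.Cfg × P.State) : Set (Equiv.Perm P.K → Prop) :=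
  obs (T.cfgObs N) (fun f => (x f).1) ∪ obs (P.stateObs (t + 1)) (fun f => (x f).2)

lemma Params.Feasible.blockBits_add_le (hP : P.Feasible N (t + 1)) : P.blockBits + t ≤ N := by
  have h1 := hP.room
  have h2 := hP.time
  rcases Nat.eq_zero_or_pos P.blockBits with h | h
  · omega
  · nlinarith

lemma Eff.simStep (hP : P.Feasible N (t + 1)) (hT : T.size ≤ N) (sec : P.Secret) (b : Bool)
    (r : Bool × P.Block) {x : Equiv.Perm P.K → T.Cfg × P.State} (hx : ∀ f, SimValid (x f) t) :
    Eff (permAnswer P) N (simObs P T N t x) 68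
      (simObs P T N t fun f => simStep sec f b r (x f)) := by
  have htN := hP.time
  have hc : EffCfg (permAnswer P) N (simObs P T N t x) 0 fun f => (x f).1 :=
    (Eff.of_subset Set.subset_union_left).effCfg
      (fun f => ⟨fun i j hj => (hx f).within.work i j (by omega), (hx f).within.query.trans
        (by omega)⟩) (fun f => (hx f).answer.trans hP.blockBits_add_le)
  have hs : SeesState (permAnswer P) N (simObs P T N t x) 0 (t + 1) fun f => (x f).2 :=
    sees_stateObs.1 (Eff.of_subset Set.subset_union_right : Eff _ _ _ 0 _).sees
  -- The reaction of the oracles is computed in every step; whether it takes effect is decided by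
  -- the instruction.
  have hy := hs.respond hP (fun f => (hx f).state) sec b r.2
    (fun f => (hx f).within.query.trans (by omega)) hc.query
  have h1 := ((hc.le (show 0 ≤ 0 + 55 by omega)).stepWith hT hy.answer r.1).eff hT le_rfl
  have hask : Dec (permAnswer P) N (simObs P T N t x) 3
      fun f => (T.instr (x f).1.state).IsAsk :=
    Dec.cases (fun f => (x f).1.state) (List.finRange T.states) (e := 1)
      (p := fun q _ => (T.instr q).IsAsk) (fun q _ => hc.state q)
      (fun q _ => Dec.const (d := 0) _) (by rw [Machine.size] at hT; simp; omega)
      (fun f hf => absurd (List.mem_finRange _) hf) (by omega) (by omega)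
  have h2 := (Sees.ite (d := 57) hask (sees_stateObs.2 hy.state) (sees_stateObs.2 hs) (by omega)
    (by omega) (by omega)).eff hP.length_stateObs_le le_rfl
  exact h1.union h2 (by omega) (by omega)

/-- The output of the interaction is computed by a circuit of polynomial size. -/
lemma Dec.simRun (hP : P.Feasible N (t + 1)) (hT : T.size ≤ N) (sec : P.Secret) (b : Bool)
    (rs : List (Bool × P.Block)) (ht : rs.length = t) (c : Option Bool) :
    Dec (permAnswer P) N ∅ 73
      fun f => Machine.output (simRun sec f b rs (T.initial [], fun _ => [])).1 = c := by
  have htN := hP.time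
  have hval : ∀ u ≤ t, ∀ f, SimValid (S4.simRun sec f b (rs.take u)
      (T.initial [], fun _ => [])) u := fun u hu f => by
    have := simValid_simRun (T := T) sec f b (rs.take u)
    rwa [List.length_take, min_eq_left (by omega)] at this
  -- The entries of `rs` are constants of the circuit, a different pair for each step.
  have h1 := Eff.iterate (φ := permAnswer P) (N := N) (a := 68) (e := 1) (d := 69)
    (T := fun u => simObs P T N t fun f => S4.simRun sec f b (rs.take u)
      (T.initial [], fun _ => [])) t (fun u hu => by
      have h2 := Eff.simStep hP hT sec b rs[u] fun f => (hval u hu.le f).mono hu.le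
      simpa only [S4.simRun, List.take_succ_eq_append_getElem (show u < rs.length by omega),
        List.foldl_append, List.foldl_cons, List.foldl_nil] using h2)
    (by rw [pow_one]; omega) le_rfl
  have h0 : Eff (permAnswer P) N ∅ 5 (simObs P T N t fun f => S4.simRun sec f b (rs.take 0)
      (T.initial [], fun _ => [])) := by
    have h2 := (EffCfg.initial (T := T) (φ := permAnswer P) (N := N) (S := ∅) (a := 0)
      (input := fun _ => []) fun i b => Dec.const (([] : List Bool)[i]? = b)).eff hT le_rfl
    have h3 := (Sees.const (φ := permAnswer P) (N := N) (S := ∅) (a := 0) (O := P.stateObs (t + 1))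
      (fun _ => [])).eff hP.length_stateObs_le le_rfl
    exact h2.union h3 (by omega) (by omega)
  have h2 := h0.bind (d := 70) (h1.left Set.subset_union_right) (by omega) (by omega)
  rw [List.take_of_length_le ht.le] at h2
  have hval' : ∀ f, SimValid (S4.simRun sec f b rs (T.initial [], fun _ => [])) t := fun f => by
    have := hval t le_rfl f
    rwa [List.take_of_length_le ht.le] at this
  have hc := (h2.right Set.subset_union_left).effCfg
    (fun f => ⟨fun i j hj => (hval' f).within.work i j (by omega), (hval' f).within.query.trans
      (by omega)⟩) (fun f => (hval' f).answer.trans hP.blockBits_add_le)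
  exact Dec.cases (fun f => (S4.simRun sec f b rs (T.initial [], fun _ => [])).1.state)
    (List.finRange T.states) (e := 1)
    (p := fun q _ => (match T.instr q with
      | .halt a => some a
      | _ => none) = c) (fun q _ => hc.state q)
    (fun q _ => Dec.const (d := 0) _) (by rw [Machine.size] at hT; simp; omega)
    (fun f hf => absurd (List.mem_finRange _) hf) (by omega) (by omega)

end Simulation

/-! ### Averaging over the coins -/

section Averaging

lemma PMF.toReal_bind {α β : Type} [Fintype α] (p : PMF α) (F : α → PMF β) (b : β) :
    (p.bind F b).toReal = ∑ a, (p a).toReal * (F a b).toReal := by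
  rw [PMF.bind_apply, tsum_fintype, ENNReal.toReal_sum]
  · simp [ENNReal.toReal_mul]
  · exact fun a _ => ENNReal.mul_ne_top (p.apply_ne_top a) ((F a).apply_ne_top b)

lemma PMF.sum_toReal {α : Type} [Fintype α] (p : PMF α) : ∑ a, (p a).toReal = 1 := by
  rw [← ENNReal.toReal_sum fun a _ => p.apply_ne_top a, ← tsum_fintype (L := .unconditional _), p.tsum_coe]
  simp

lemma PMF.map_decide_eq {α : Type} [DecidableEq α] (p : PMF α) (a : α) :
    p.map (fun x => decide (x = a)) true = p a := by
  rw [PMF.map_apply, tsum_eq_single a]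
  · simp
  · intro x hx
    simp [hx]

variable {Ω α : Type} [Fintype Ω] [Fintype α]

/-- Averaging: if `μ` is a linear functional, then its value at a mean is at most its largest value
at the terms. -/
lemma exists_abs_le_of_mean (μ : Ω → ℝ) (p : PMF α) (H : α → Ω → ℝ) :
    ∃ a, |∑ f, μ f * ∑ a, (p a).toReal * H a f| ≤ |∑ f, μ f * H a f| := by
  obtain ⟨a₁, -⟩ := p.support_nonempty
  have : Nonempty α := ⟨a₁⟩
  obtain ⟨a₀, h₀⟩ := Finite.exists_max fun a => |∑ f, μ f * H a f|
  refine ⟨a₀, ?_⟩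
  have h1 : ∑ f, μ f * ∑ a, (p a).toReal * H a f = ∑ a, (p a).toReal * ∑ f, μ f * H a f := by
    simp only [Finset.mul_sum]
    rw [Finset.sum_comm]
    exact Finset.sum_congr rfl fun a _ => Finset.sum_congr rfl fun f _ => by ring
  rw [h1]
  calc _ ≤ ∑ a, |(p a).toReal * ∑ f, μ f * H a f| := Finset.abs_sum_le_sum_abs _ _
    _ ≤ ∑ a, (p a).toReal * |∑ f, μ f * H a₀ f| := by
        refine Finset.sum_le_sum fun a _ => ?_
        rw [abs_mul, abs_of_nonneg ENNReal.toReal_nonneg]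
        exact mul_le_mul_of_nonneg_left (h₀ a) ENNReal.toReal_nonneg
    _ = _ := by rw [← Finset.sum_mul, PMF.sum_toReal, one_mul]

end Averaging

section

open Params

variable {k : ℕ} {P : Params k} {T : Machine}

open Classical in
/-- The coins and the initial states of the sessions can be fixed. -/
lemma exists_simRun [Fintype (Equiv.Perm P.K)] (μ : Equiv.Perm P.K → ℝ) (sec : P.Secret) (b : Bool)
    (c : Option Bool) (t : ℕ) (x : Equiv.Perm P.K → T.Cfg × P.State) :
    ∃ rs : List (Bool × P.Block), rs.length = t ∧
      |∑ f, μ f * (((Machine.run (P.oracle sec f b) t (x f)).map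
          fun y => Machine.output y.1) c).toReal| ≤
        |∑ f, μ f * if Machine.output (simRun sec f b rs (x f)).1 = c then 1 else 0| := by
  let _ : Fintype P.Block := Fintype.ofFinite _
  -- The start must be allowed to depend on `f`, as the configuration does after the first answer.
  induction t generalizing x with
  | zero =>
    refine ⟨[], rfl, le_of_eq ?_⟩
    congr 1
    refine Finset.sum_congr rfl fun f _ => ?_
    rw [Machine.run, PMF.pure_map, PMF.pure_apply]
    by_cases h : Machine.output (x f).1 = c
    · simp [simRun, h]
    · simp [simRun, h, Ne.symm h]
  | succ t ih =>
    simp only [Machine.run, step_oracle, PMF.bind_bind, PMF.pure_bind, PMF.map_bind,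
      PMF.toReal_bind]
    -- The coin and then the block are chosen to maximise the whole sum over `f`, so they are the
    -- same for all `f`.
    obtain ⟨a, ha⟩ := exists_abs_le_of_mean μ (PMF.uniformOfFintype Bool) fun a f =>
      ∑ s, ((PMF.uniformOfFintype P.Block) s).toReal *
        (((Machine.run (P.oracle sec f b) t (simStep sec f b (a, s) (x f))).map
          fun y => Machine.output y.1) c).toReal
    obtain ⟨s, hs⟩ := exists_abs_le_of_mean μ (PMF.uniformOfFintype P.Block) fun s f =>
      (((Machine.run (P.oracle sec f b) t (simStep sec f b (a, s) (x f))).map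
          fun y => Machine.output y.1) c).toReal
    obtain ⟨rs, h1, h2⟩ := ih fun f => simStep sec f b (a, s) (x f)
    exact ⟨(a, s) :: rs, by simp [h1], ha.trans (hs.trans h2)⟩

/-- Averaging picks a maximum over the secret matrices, so these must range over a finite type. -/
instance : Finite P.Secret :=
  Finite.of_injective (fun s : P.Secret => (s.W, s.L, s.F)) fun s s' h => by
    cases s
    cases s'
    simpa using h

open Classical in
/-- The difference between the success probabilities of an adversary, for two ensembles, is
bounded for suitable outcomes of everything that does not depend on the permutation. -/
lemma exists_experiment_le {P : ∀ k, Params k} (secret : ∀ k, PMF (P k).Secret)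
    (X Y : Ensemble P) (A : PPT) (k : ℕ) :
    letI : Fintype (Equiv.Perm (P k).K) := Fintype.ofFinite _
    ∃ (sec : (P k).Secret) (b : Bool) (rs : List (Bool × (P k).Block)),
      rs.length = A.bound.eval k ∧
      |(experiment P secret X A k true).toReal - (experiment P secret Y A k true).toReal| ≤
        |∑ f, ((X k f).toReal - (Y k f).toReal) * if Machine.output (simRun sec f b rs
          ((A.machine k).initial [], fun _ => [])).1 = some b then 1 else 0| := by
  let _ : Fintype (Equiv.Perm (P k).K) := Fintype.ofFinite _
  let _ : Fintype (P k).Secret := Fintype.ofFinite _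
  have h1 : ∀ X : Ensemble P, (experiment P secret X A k true).toReal =
      ∑ f, (X k f).toReal * ∑ sec, (secret k sec).toReal *
        ∑ b, (PMF.uniformOfFintype Bool b).toReal *
          (A.outcome k ((P k).oracle sec f b) (fun _ => []) (some b)).toReal := by
    intro X
    simp only [experiment, PMF.toReal_bind, PMF.map_decide_eq]
  rw [h1, h1, ← Finset.sum_sub_distrib]
  simp only [← sub_mul]
  -- Averaging is applied to the difference of the two distributions, so that the same fixed data
  -- serve both ensembles.
  set μ : Equiv.Perm (P k).K → ℝ := fun f => (X k f).toReal - (Y k f).toReal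
  obtain ⟨sec, hsec⟩ := exists_abs_le_of_mean μ (secret k) fun sec f =>
    ∑ b, (PMF.uniformOfFintype Bool b).toReal *
      (A.outcome k ((P k).oracle sec f b) (fun _ => []) (some b)).toReal
  obtain ⟨b, hb⟩ := exists_abs_le_of_mean μ (PMF.uniformOfFintype Bool) fun b f =>
    (A.outcome k ((P k).oracle sec f b) (fun _ => []) (some b)).toReal
  obtain ⟨rs, h2, h3⟩ := exists_simRun (T := A.machine k) μ sec b (some b) (A.bound.eval k)
    fun _ => ((A.machine k).initial [], fun _ => [])
  exact ⟨sec, b, rs, h2, hsec.trans (hb.trans h3)⟩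

end

/-! ### Polynomial bounds -/

section Bounds

lemma eval_mono (p : ℕ[X]) {a b : ℕ} (h : a ≤ b) : p.eval a ≤ p.eval b := by
  simp only [Polynomial.eval_eq_sum, Polynomial.sum]
  gcongr

namespace Params

variable {k : ℕ} (P : Params k)

/-- For `k ≠ 0` neither `n` nor `e` vanishes, so `2 ^ n`, `2 ^ e` and `p` are all at most `q ^ n`.
For `k = 0` one of them is zero and the other parameters are not bounded by `k`. -/
lemma size_le (hk : k ≠ 0) : P.n ≤ k ∧ P.e ≤ k ∧ P.digitBits ≤ k := by
  have hs := P.security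
  have hp := P.prime.out.two_le
  have hn : P.n ≠ 0 := by
    intro h
    rw [h] at hs
    simp at hs
    exact hk hs
  have he : P.e ≠ 0 := by
    intro h
    rw [h] at hs
    simp at hs
    exact hk hs
  have h1 : P.p ≤ P.p ^ P.e := Nat.le_self_pow he _
  have h2 : P.p ^ P.e ≤ (P.p ^ P.e) ^ P.n := Nat.le_self_pow hn _
  have key : ∀ m, 2 ^ m ≤ (P.p ^ P.e) ^ P.n → m ≤ k := fun m hm => by
    rw [hs, ← Nat.clog_pow 2 m (by norm_num)]
    exact Nat.clog_mono_right 2 hm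
  refine ⟨key _ (Nat.pow_le_pow_left (hp.trans h1) _),
    key _ ((Nat.pow_le_pow_left hp _).trans h2), ?_⟩
  conv_rhs => rw [hs]
  exact Nat.clog_mono_right 2 (h1.trans h2)

end Params

open Params

/-- For an efficient cryptosystem, there is a polynomial bound for everything that is needed to
simulate an adversary. -/
lemma exists_feasible (P : ∀ k, Params k) (hP : Efficient P) (A : PPT) :
    ∃ p : ℕ[X], ∀ k, (P k).Feasible (p.eval k) (A.bound.eval k + 1) ∧
      (A.machine k).size ≤ p.eval k := by
  obtain ⟨q, hell, hsigma⟩ := hP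
  have hbits : ∃ r : ℕ[X], ∀ k, (P k).n ≤ r.eval k ∧ (P k).digitBits ≤ r.eval k ∧
      (P k).elemBits ≤ r.eval k ∧ (P k).blockBits ≤ r.eval k := by
    -- The constant takes care of `k = 0`, the powers of `X` of all other `k`.
    refine ⟨C ((P 0).n + (P 0).digitBits + (P 0).elemBits + (P 0).blockBits) + X + X ^ 2 + X ^ 3,
      fun k => ?_⟩
    simp only [eval_add, eval_C, eval_X, eval_pow]
    rcases eq_or_ne k 0 with rfl | hk
    · omega
    · obtain ⟨h1, h2, h3⟩ := (P k).size_le hk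
      have h4 : (P k).elemBits ≤ k ^ 2 := by
        rw [elemBits, sq]
        exact Nat.mul_le_mul h2 h3
      have h5 : (P k).blockBits ≤ k ^ 3 := by
        rw [blockBits, pow_succ']
        exact Nat.mul_le_mul h1 h4
      omega
  obtain ⟨r, hr⟩ := hbits
  -- The summands bound, in turn, the encodings, the modes and switching machines up to time
  -- `A.bound + 1`, the adversary's size and running time, and the code of all ciphertext blocks of
  -- a session.
  refine ⟨r + q.comp (X + A.bound + 1) + A.bound + 3 + (A.bound + 2) * r, fun k => ?_⟩
  simp only [eval_add, eval_comp, eval_X, eval_one, eval_mul, eval_ofNat]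
  obtain ⟨h1, h2, h3, h4⟩ := hr k
  have h5 := A.size_le k
  have h6 : ∀ m, m ≤ k + A.bound.eval k + 1 → q.eval m ≤ q.eval (k + A.bound.eval k + 1) :=
    fun m hm => eval_mono q hm
  refine ⟨⟨⟨by omega, by omega, by omega, by omega⟩, ?_, by omega, ?_, fun u hu => ?_⟩, by omega⟩
  · have := (hell k).trans (h6 k (by omega))
    omega
  · have : (A.bound.eval k + 1 + 1) * (P k).blockBits ≤ (A.bound.eval k + 2) * r.eval k :=
      Nat.mul_le_mul (by omega) h4
    omega
  · obtain ⟨T, hT, h⟩ := hsigma k u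
    have := h6 (k + u) (by omega)
    exact ⟨T, by omega, q.eval (k + u), by omega, fun cs hcs => (h cs hcs _ _).2⟩

end Bounds

/-- A machine that distinguishes two ensembles of permutations at least as well as an adversary
against the cryptosystem. -/
theorem exists_distinguisher (P : ∀ k, Params k) (hP : Efficient P)
    (secret : ∀ k, PMF (P k).Secret) (X Y : Ensemble P) (A : PPT) :
    ∃ D : PPT, ∀ k,
      |(experiment P secret X A k true).toReal - (experiment P secret Y A k true).toReal| ≤
        |acceptProb X D k - acceptProb Y D k| := by
  classical
  obtain ⟨p, hp⟩ := exists_feasible P hP A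
  choose sec b rs hrs hle using exists_experiment_le secret X Y A
  -- The machines are chosen separately for every `k`; this is where non-uniformity enters.
  choose T hsize hhalt hrun using fun k => Builds.exists_machine
    (Dec.simRun (hp k).1 (hp k).2 (sec k) (b k) (rs k) (hrs k) (some (b k)))
  refine ⟨⟨T, 9 * (p + 4) ^ 73 + 6, fun k => ?_, fun k coins answers => hhalt k _ ?_ coins answers⟩,
    fun k => (hle k).trans (le_of_eq ?_)⟩
  · simpa using hsize k
  · simp only [eval_add, eval_mul, eval_pow, eval_ofNat]
    omega
  · let _ : Fintype (Equiv.Perm (P k).K) := Fintype.ofFinite _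
    have h1 : ∀ X : Ensemble P, acceptProb X ⟨T, 9 * (p + 4) ^ 73 + 6, fun k => by
        simpa using hsize k, fun k coins answers => hhalt k _ (by
          simp only [eval_add, eval_mul, eval_pow, eval_ofNat]; omega) coins answers⟩ k
        = ∑ f, (X k f).toReal * if Machine.output (simRun (sec k) f (b k) (rs k)
          ((A.machine k).initial [], fun _ => [])).1 = some (b k) then 1 else 0 := by
      intro X
      rw [acceptProb, PMF.toReal_bind]
      refine Finset.sum_congr rfl fun f _ => ?_
      rw [PPT.outcome, hrun k f ((P k).permOracle f) (fun w => rfl) _ (by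
        simp only [eval_add, eval_mul, eval_pow, eval_ofNat]; omega), PMF.pure_apply]
      congr 1
      split_ifs with h2 h3 h3 <;> simp_all
    rw [h1, h1, ← Finset.sum_sub_distrib]
    simp only [← sub_mul]

/-- A positive negligible function, which is added to make the final inequality strict. -/
lemma negligible_exp : Negligible fun k => Real.exp (-k) := fun n => by
  have h := (Real.tendsto_pow_mul_exp_neg_atTop_nhds_zero n).comp tendsto_natCast_atTop_atTop
  exact h

end S4

theorem mainTheorem2
    (P : ∀ k, S4.Params k) (hP : S4.Efficient P)
    (secret : ∀ k, PMF (P k).Secret)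
    (𝔓 : S4.KeyedFamily P) (h𝔓 : 𝔓.Pseudorandom)
    (A : S4.PPT) :
    ∃ negl : ℕ → ℝ, S4.Negligible negl ∧
      ∀ k, |S4.advantage P secret 𝔓.ensemble A k
          - S4.advantage P secret (S4.uniform P) A k| < negl k := by
  obtain ⟨D, hD⟩ := S4.exists_distinguisher P hP secret 𝔓.ensemble (S4.uniform P) A
  refine ⟨_, ((h𝔓 D).const_mul 2).add S4.negligible_exp, fun k => ?_⟩
  refine lt_of_le_of_lt ?_ (lt_add_of_pos_right _ (Real.exp_pos _))
  refine le_trans ?_ (mul_le_mul_of_nonneg_left (hD k) zero_le_two)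
  rw [S4.advantage, S4.advantage, ← mul_sub, abs_mul, abs_two]
  -- By the reverse triangle inequality the outer absolute values drop out, and the two halves
  -- cancel.
  refine mul_le_mul_of_nonneg_left ((abs_abs_sub_abs_le_abs_sub _ _).trans (le_of_eq ?_)) zero_le_two
  rw [sub_sub_sub_cancel_right]
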